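/- Let $(R,\mathfrak m)$ be a commutative Noetherian local ring that is not Gorenstein, with $\mathfrak m^3=0$ and $\mathfrak m^2\neq 0$, and containing a coefficient field $k$ (a subfield mapping isomorphically onto $R/\mathfrak m$). Let $r=\dim_k\operatorname{Hom}_R(k,R)$ be the type of $R$. All modules are finitely generated; an $R$-module $M$ has G-dimension zero if the natural map $M\to M^{**}$ is an isomorphism and $\operatorname{Ext}^i_R(M,R)=\operatorname{Ext}^i_R(M^*,R)=0$ for all $i>0$, where $M^*=\operatorname{Hom}_R(M,R)$. Suppose that there is a nonfree $R$-module of G-dimension zero. Then $R$ has a grading $R=R_0\oplus R_1\oplus R_2$ by $k$-subspaces such that the following hold. (1) $R$ is a homogeneous graded $k$-algebra, i.e. $R_0=k$ and $R$ is generated as a $k$-algebra by $R_1$; moreover $\dim_k R_1=r+1$ and $\dim_k R_2=r$, so that its Hilbert series is $H_R(t)=\sum_i(\dim_k R_i)t^i=(1+t)(1+rt)$; and $(0:_R\mathfrak m)=\mathfrak m^2$. (2) With this grading $R$ is a Koszul algebra, i.e. the graded module $k$ has a linear graded free resolution over $R$, and its Poincaré series is $$P_R(t)=\sum_{i\ge0}\dim_k\operatorname{Tor}_i^R(k,k)\,t^i=\frac1{(1-t)(1-rt)}.$$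 (3) The Bass series of $R$ is $$B_R(t)=\sum_{i\ge0}\dim_k\operatorname{Ext}^i_R(k,R)\,t^i=\frac{r-t}{1-rt}.$$ (4) Every $R$-module $M$ of G-dimension zero admits a structure of graded module over the graded ring $R$. If moreover $M$ has no nonzero free direct summand, then such a structure can be chosen with only two pieces, $M=M_0\oplus M_1$, such that, with $b=\dim_k M_0$: $b$ is the minimal number of generators of $M$, $\dim_k M_1=rb$, the length of $M$ is $\ell_R(M)=b(1+r)$, and $M$ has a graded free resolution (with maps homogeneous of degree $0$) $$\cdots\to R(-n-1)^b\to R(-n)^b\to\cdots\to R(-1)^b\to R^b\to M\to0.$$ -/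

import Mathlib

open CategoryTheory IsLocalRing

universe u

/-- A Noetherian local ring is Gorenstein if it has finite injective dimension as a module over
itself. -/
def IsGorensteinLocalRing (R : Type u) [CommRing R] [IsLocalRing R] [IsNoetherianRing R] : Prop :=
  ∃ n : ℕ, HasInjectiveDimensionLT (ModuleCat.of R R) n

/-- An `R`-module `M` (finitely generated in all uses) has G-dimension zero if the biduality map
`M → M**` is an isomorphism and `Ext^i_R(M, R) = 0 = Ext^i_R(M*, R)` for all `i > 0`. -/
structure HasGDimensionZero (R : Type u) [CommRing R] (M : Type u) [AddCommGroup M]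
    [Module R M] : Prop where
  bijective_eval : Function.Bijective (Module.Dual.eval R M)
  ext_eq_zero : ∀ i : ℕ, 0 < i →
    Subsingleton (Abelian.Ext (ModuleCat.of R M) (ModuleCat.of R R) i)
  ext_dual_eq_zero : ∀ i : ℕ, 0 < i →
    Subsingleton (Abelian.Ext (ModuleCat.of R (Module.Dual R M)) (ModuleCat.of R R) i)

/-- `M` has no nonzero free direct summand. -/
def HasNoFreeSummand (R : Type*) [CommRing R] (M : Type*) [AddCommGroup M] [Module R M] : Prop :=
  ∀ N P : Submodule R M, IsCompl N P → Module.Free R N → N = ⊥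

section Invariants

variable (k : Type*) [Field k] (R : Type u) [CommRing R] [IsLocalRing R] [Algebra k R]

/-- The `k`-dimension of an `R`-module, `R` being a `k`-algebra. -/
noncomputable def kdim (X : Type*) [AddCommGroup X] [Module R X] : ℕ :=
  Module.finrank k (RestrictScalars k R X)

/-- The type of `R`: the dimension of `Hom_R(R/𝔪, R)`. -/
noncomputable def typeOfLocalRing : ℕ :=
  kdim k R (ResidueField R →ₗ[R] R)

/-- The Bass series `∑ dim_k Ext^i_R(R/𝔪, R) t^i`. -/
noncomputable def bassSeries : PowerSeries ℚ :=
  PowerSeries.mk fun i =>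
    (kdim k R (Abelian.Ext (ModuleCat.of R (ResidueField R)) (ModuleCat.of R R) i) : ℚ)

/-- The Poincaré series `∑ dim_k Tor_i^R(R/𝔪, R/𝔪) t^i`. -/
noncomputable def poincareSeries : PowerSeries ℚ :=
  PowerSeries.mk fun i =>
    (kdim k R (((Tor (ModuleCat.{u} R) i).obj (ModuleCat.of R (ResidueField R))).obj
      (ModuleCat.of R (ResidueField R))) : ℚ)

end Invariants

section Graded

variable {k : Type*} [Field k] {R : Type*} [CommRing R] [Algebra k R]

/-- The Hilbert series `∑ dim_k R_i t^i` of a grading. -/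
noncomputable def hilbertSeries (𝒜 : ℕ → Submodule k R) : PowerSeries ℚ :=
  PowerSeries.mk fun i => (Module.finrank k (𝒜 i) : ℚ)

/-- A graded algebra is homogeneous (standard graded) if `R_0 = k` and `R = k[R_1]`. -/
structure IsHomogeneousGraded (𝒜 : ℕ → Submodule k R) : Prop where
  zero_eq : 𝒜 0 = LinearMap.range (Algebra.linearMap k R)
  adjoin_one : Algebra.adjoin k (𝒜 1 : Set R) = ⊤

/-- The homogeneous piece of degree `j` of the graded free module `R(-n)^b`,
where `R(-n)_j = R_{j - n}`. -/
def twistedFree (𝒜 : ℕ → Submodule k R) (n b : ℕ) (j : ℕ) : Submodule k (Fin b → R) :=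
  Submodule.pi Set.univ fun _ => if n ≤ j then 𝒜 (j - n) else ⊥

/-- The graded module `(M, ℳ)` has a linear free resolution
`⋯ → R(-n-1)^{β (n+1)} → R(-n)^{β n} → ⋯ → R(-1)^{β 1} → R^{β 0} → M → 0`:
an exact sequence of `R`-linear maps that are homogeneous of degree zero. -/
def HasLinearResolution (𝒜 : ℕ → Submodule k R) {M : Type*} [AddCommGroup M] [Module R M]
    [Module k M] (ℳ : ℕ → Submodule k M) (β : ℕ → ℕ) : Prop :=
  ∃ (d : ∀ n : ℕ, (Fin (β (n + 1)) → R) →ₗ[R] (Fin (β n) → R))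
    (ε : (Fin (β 0) → R) →ₗ[R] M),
    Function.Surjective ε ∧
    Function.Exact (d 0) ε ∧
    (∀ n, Function.Exact (d (n + 1)) (d n)) ∧
    (∀ j, ∀ x ∈ twistedFree 𝒜 0 (β 0) j, ε x ∈ ℳ j) ∧
    (∀ n j, ∀ x ∈ twistedFree 𝒜 (n + 1) (β (n + 1)) j, d n x ∈ twistedFree 𝒜 n (β n) j)

/-- A homogeneous graded `k`-algebra `R` is Koszul if the graded module `k = R/R_+`, placed in
degree `0`, has a linear free resolution. -/
def IsKoszulGraded (𝒜 : ℕ → Submodule k R) [GradedAlgebra 𝒜] : Prop :=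
  IsHomogeneousGraded 𝒜 ∧
  ∃ β : ℕ → ℕ, HasLinearResolution 𝒜
    (M := R ⧸ (HomogeneousIdeal.irrelevant 𝒜).toIdeal) (fun j => if j = 0 then ⊤ else ⊥) β

/-- `ℳ` makes `M` a graded module over the graded ring `(R, 𝒜)`. -/
structure IsModuleGrading (𝒜 : ℕ → Submodule k R) {M : Type*} [AddCommGroup M] [Module R M]
    [Module k M] (ℳ : ℕ → Submodule k M) : Prop where
  isInternal : DirectSum.IsInternal ℳ
  smul_mem : ∀ i j, ∀ a ∈ 𝒜 i, ∀ x ∈ ℳ j, a • x ∈ ℳ (i + j)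

end Graded

/-!
Let `κ` be the residue field, `r` the type of `R`, and call a module stable if it has G-dimension
zero and all its functionals take values in `𝔪`.  A finitely generated module of G-dimension zero is
the direct sum of a free module and a stable one (`HasGDimensionZero.exists_equiv_free_prod`), so the
given nonfree module yields a nonzero stable module `M`.  Duals and syzygies of stable modules are
stable.  As `𝔪³ = 0`, stable modules are killed by `𝔪²`, hence `M / 𝔪 M` and `𝔪 M` are sums of copies
of `κ`, in numbers `b(M)` and `c(M)`, say.

*Numbers of generators.*  The vanishing of `Ext(M, R)` and the long exact sequence of
`0 → 𝔪 M → M → M / 𝔪 M → 0` show that `c(M) : b(M)` is `μ² : μ¹` for the Bass numbers `μⁱ` of `R`; here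
`μ¹ ≠ 0` because `R` is not self-injective.  So this ratio does not depend on the stable module `M`.
Comparing lengths in `0 → K → F → M → 0`, where `F → M` is a minimal free cover, in its dual, and in
the corresponding sequence for `M*`, one finds `b(K) = b(M) = b(M*)` (`IsStableGZero.numGen_dual`,
`IsStableGZero.numGen_ker`).

*Socles.*  Since `M ≃ M**`, the socle of `M` is `Hom(M* / 𝔪 M*, R)`, of length `r b(M)`.  So `K` and
`F` have socles of the same length, and `soc F ⊆ K`.  A socle element of `K` outside `𝔪 K` would make
`κ` a direct summand of `K` and give `Ext¹(κ, R) = 0`; hence `soc F ⊆ 𝔪 K ⊆ 𝔪² F`.  It follows that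
`soc R = 𝔪²` and `𝔪 K = 𝔪² F` (`socle_self_eq`, `IsStableGZero.smul_ker_eq`), so that `c(M) = r b(M)`
and `R` has length `2 (1 + r)`.  The Bass numbers are now read off from the same long exact sequence.

*Koszul property.*  From `𝔪 K = 𝔪² F` one proves by induction on the degree that
`Ext(M / 𝔪 M, κ) → Ext(M, κ)` is surjective (`IsStableGZero.extMap_mkQ_surjective`), which gives the
recursion `βᵢ₊₁ = r βᵢ + 1` for the dimensions of `Extⁱ(κ, κ)`.  These numbers determine the lengths of
the syzygies `K ⊆ 𝔪 F` of `κ`, and a count of lengths shows `𝔪 K = 𝔪² F` for them as well.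

*Gradings.*  Choose a `k`-complement `V` of `𝔪²` in `𝔪`; then `R = k ⊕ V ⊕ 𝔪²` is a graded algebra
generated by `V`.  A submodule `K ⊆ 𝔪 F` with `𝔪 K = 𝔪² F` is minimally generated by elements with
coordinates in `V` (`exists_linear_cover`), because subtracting an element of `𝔪² F` does not change the
class of an element of `K` modulo `𝔪 K`.  Applied to all syzygies of `κ` and of `M`, this produces
linear resolutions (`exists_linear_resolution`); that of `κ` is minimal and so computes `Tor(κ, κ)`
(`nonempty_tor_residueField_equiv`).  A stable module is graded by `M = M₀ ⊕ 𝔪 M`, for any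
`k`-complement `M₀` of `𝔪 M`, and free modules are graded by the grading of `R`.
-/

/-! ### Length -/

section Length

variable {R : Type*} [CommRing R]

/-- The length of a module as a natural number, with value `0` if the length is infinite.  It is
only used for finitely generated modules over an Artinian ring, where the length is finite. -/
noncomputable def ell (R : Type*) [CommRing R] (X : Type*) [AddCommGroup X] [Module R X] : ℕ :=
  (Module.length R X).toNat

theorem ell_congr {X Y : Type*} [AddCommGroup X] [Module R X] [AddCommGroup Y] [Module R Y]
    (e : X ≃ₗ[R] Y) : ell R X = ell R Y := by
  rw [ell, ell, e.length_eq]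

theorem ell_of_subsingleton {X : Type*} [AddCommGroup X] [Module R X] [Subsingleton X] :
    ell R X = 0 := by
  simp [ell]

theorem mem_smul_top_pi_iff {I : Ideal R} {n : ℕ} {x : Fin n → R} :
    x ∈ (I • ⊤ : Submodule R (Fin n → R)) ↔ ∀ i, x i ∈ I := by
  constructor
  · intro hx i
    have : (I • ⊤ : Submodule R (Fin n → R)) ≤
        Submodule.comap (LinearMap.proj i : (Fin n → R) →ₗ[R] R) I := by
      rw [Submodule.smul_le]
      intro a ha y _
      exact I.mul_mem_right _ ha
    exact this hx
  · intro hx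
    rw [pi_eq_sum_univ' x]
    exact Submodule.sum_mem _ fun i _ => Submodule.smul_mem_smul (hx i) trivial

variable [IsArtinianRing R]

theorem coe_ell (X : Type*) [AddCommGroup X] [Module R X] [Module.Finite R X] :
    (ell R X : ℕ∞) = Module.length R X :=
  ENat.natCast_toNat Module.length_ne_top

theorem ell_eq_add_of_exact {A B C : Type*} [AddCommGroup A] [Module R A] [AddCommGroup B]
    [Module R B] [AddCommGroup C] [Module R C] [Module.Finite R B] (f : A →ₗ[R] B) (g : B →ₗ[R] C)
    (hf : Function.Injective f) (hg : Function.Surjective g) (h : Function.Exact f g) :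
    ell R B = ell R A + ell R C := by
  have : Module.Finite R A := Module.Finite.of_injective f hf
  have : Module.Finite R C := Module.Finite.of_surjective g hg
  have := Module.length_eq_add_of_exact f g hf hg h
  rw [← coe_ell, ← coe_ell, ← coe_ell] at this
  exact_mod_cast this

theorem ell_quotient_add_ell {X : Type*} [AddCommGroup X] [Module R X] [Module.Finite R X]
    (N : Submodule R X) : ell R (X ⧸ N) + ell R N = ell R X := by
  rw [ell_eq_add_of_exact N.subtype N.mkQ N.injective_subtype N.mkQ_surjective
    (LinearMap.exact_subtype_mkQ N), add_comm]

theorem ell_ker_add_ell_range {X Y : Type*} [AddCommGroup X] [Module R X] [Module.Finite R X]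
    [AddCommGroup Y] [Module R Y] (f : X →ₗ[R] Y) :
    ell R (LinearMap.ker f) + ell R (LinearMap.range f) = ell R X := by
  rw [← ell_quotient_add_ell (LinearMap.ker f), ell_congr f.quotKerEquivRange, add_comm]

theorem ell_pi (n : ℕ) (X : Type*) [AddCommGroup X] [Module R X] [Module.Finite R X] :
    ell R (Fin n → X) = n * ell R X := by
  have h := Module.length_pi (R := R) (M := X) (ι := Fin n)
  rw [← coe_ell, ← coe_ell] at h
  simp only [ENat.card_eq_coe_fintype_card, Fintype.card_fin] at h
  exact_mod_cast h

theorem ell_eq_zero_iff {X : Type*} [AddCommGroup X] [Module R X] [Module.Finite R X] :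
    ell R X = 0 ↔ Subsingleton X := by
  rw [← Module.length_eq_zero_iff (R := R), ← coe_ell]
  simp

theorem ell_pos {X : Type*} [AddCommGroup X] [Module R X] [Module.Finite R X] [Nontrivial X] :
    0 < ell R X := by
  rw [Nat.pos_iff_ne_zero, ne_eq, ell_eq_zero_iff, not_subsingleton_iff_nontrivial]
  infer_instance

theorem Submodule.eq_of_le_of_ell_le {X : Type*} [AddCommGroup X] [Module R X]
    [Module.Finite R X] {N P : Submodule R X} (h : N ≤ P) (h' : ell R P ≤ ell R N) : N = P := by
  have h1 := ell_quotient_add_ell (N.submoduleOf P)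
  rw [ell_congr (Submodule.submoduleOfEquivOfLe h)] at h1
  have h2 : ell R (P ⧸ N.submoduleOf P) = 0 := by omega
  rw [ell_eq_zero_iff, Submodule.Quotient.subsingleton_iff] at h2
  exact le_antisymm h (Submodule.submoduleOf_eq_top.mp h2)

end Length

/-! ### Minimal covers over a local ring -/

section Residue

variable {R : Type*} [CommRing R] [IsLocalRing R]

local notation "𝔪" => maximalIdeal R
local notation "κ" => ResidueField R

instance : Module.Finite R (ResidueField R) :=
  inferInstanceAs (Module.Finite R (R ⧸ maximalIdeal R))

instance isSimpleModule_residueField : IsSimpleModule R (ResidueField R) :=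
  isSimpleModule_iff_isCoatom.mpr (maximalIdeal.isMaximal R).out

theorem ell_residueField : ell R κ = 1 := by
  simp [ell, Module.length_eq_one]

theorem smul_residueField_eq_zero {a : R} (ha : a ∈ 𝔪) (x : κ) : a • x = 0 := by
  rw [Algebra.smul_def, ResidueField.algebraMap_eq, (residue_eq_zero_iff a).mpr ha, zero_mul]

/-- A finitely generated module killed by the maximal ideal is a sum of copies of the residue
field, as many as its length. -/
theorem exists_equiv_pi_residueField [IsArtinianRing R] (V : Type*) [AddCommGroup V] [Module R V]
    [Module.Finite R V] (h : ∀ a ∈ 𝔪, ∀ v : V, a • v = 0) :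
    Nonempty (V ≃ₗ[R] (Fin (ell R V) → κ)) := by
  have ht : Module.IsTorsionBySet R V (𝔪 : Set R) := fun x a => h a a.2 x
  let : Module κ V := ht.module
  have : IsScalarTower R κ V := ht.isScalarTower
  have : Module.Finite κ V := Module.Finite.of_restrictScalars_finite R κ V
  let e : V ≃ₗ[R] (Fin (Module.finrank κ V) → κ) :=
    ((Module.finBasis κ V).equivFun).restrictScalars R
  have he : ell R V = Module.finrank κ V := by
    rw [ell_congr e, ell_pi, ell_residueField, mul_one]
  rw [he]
  exact ⟨e⟩

variable (R) in
/-- The number of elements of a minimal generating set, as the length of `X / 𝔪 X`. -/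
noncomputable def numGen (X : Type*) [AddCommGroup X] [Module R X] : ℕ :=
  ell R (X ⧸ (𝔪 • ⊤ : Submodule R X))

theorem numGen_congr {X Y : Type*} [AddCommGroup X] [Module R X] [AddCommGroup Y] [Module R Y]
    (e : X ≃ₗ[R] Y) : numGen R X = numGen R Y := by
  refine ell_congr (Submodule.Quotient.equiv _ _ e ?_)
  rw [Submodule.map_smul'']
  simp

theorem numGen_add_ell_smul_top [IsArtinianRing R] (X : Type*) [AddCommGroup X] [Module R X]
    [Module.Finite R X] : numGen R X + ell R (𝔪 • ⊤ : Submodule R X) = ell R X :=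
  ell_quotient_add_ell _

theorem ell_smul_top_coe {X : Type*} [AddCommGroup X] [Module R X] (K : Submodule R X) :
    ell R (𝔪 • ⊤ : Submodule R K) = ell R (𝔪 • K : Submodule R X) := by
  rw [ell_congr (Submodule.equivMapOfInjective _ (Submodule.injective_subtype _) (𝔪 • ⊤)),
    Submodule.map_smul'', Submodule.map_subtype_top]

theorem smul_top_quotient_eq_zero {X : Type*} [AddCommGroup X] [Module R X] {a : R} (ha : a ∈ 𝔪)
    (x : X ⧸ (𝔪 • ⊤ : Submodule R X)) : a • x = 0 := by
  obtain ⟨x, rfl⟩ := Submodule.mkQ_surjective _ x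
  rw [← map_smul, Submodule.mkQ_apply, Submodule.Quotient.mk_eq_zero]
  exact Submodule.smul_mem_smul ha trivial

theorem numGen_eq_zero_iff [IsArtinianRing R] {X : Type*} [AddCommGroup X] [Module R X]
    [Module.Finite R X] : numGen R X = 0 ↔ Subsingleton X := by
  rw [numGen, ell_eq_zero_iff, Submodule.Quotient.subsingleton_iff]
  constructor
  · intro h
    rw [← Submodule.subsingleton_iff R, ← subsingleton_iff_bot_eq_top, eq_comm]
    exact Submodule.eq_bot_of_le_smul_of_le_jacobson_bot 𝔪 ⊤ Module.Finite.fg_top h.ge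
      (maximalIdeal_le_jacobson ⊥)
  · intro h
    exact Subsingleton.elim _ _

theorem numGen_pos [IsArtinianRing R] (X : Type*) [AddCommGroup X] [Module R X]
    [Module.Finite R X] [Nontrivial X] : 0 < numGen R X := by
  rw [Nat.pos_iff_ne_zero, ne_eq, numGen_eq_zero_iff, not_subsingleton_iff_nontrivial]
  infer_instance

theorem span_eq_top_of_sup_smul_top {X : Type*} [AddCommGroup X] [Module R X] [Module.Finite R X]
    {N : Submodule R X} (h : N ⊔ 𝔪 • ⊤ = ⊤) : N = ⊤ :=
  top_le_iff.mp (Submodule.le_of_le_smul_of_le_jacobson_bot (I := 𝔪) (N' := ⊤)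
    Module.Finite.fg_top (maximalIdeal_le_jacobson ⊥) h.ge)

theorem numGen_eq_of_surjective {X Y : Type*} [AddCommGroup X] [Module R X]
    [AddCommGroup Y] [Module R Y] (f : X →ₗ[R] Y) (hf : Function.Surjective f)
    (hk : LinearMap.ker f ≤ 𝔪 • ⊤) : numGen R X = numGen R Y := by
  let g : X →ₗ[R] Y ⧸ (𝔪 • ⊤ : Submodule R Y) := (Submodule.mkQ _).comp f
  have hg : LinearMap.ker g = 𝔪 • ⊤ := by
    rw [LinearMap.ker_comp, Submodule.ker_mkQ, ← LinearMap.range_eq_top.mpr hf,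
      LinearMap.range_eq_map, ← Submodule.map_smul'', Submodule.comap_map_eq, sup_eq_left]
    exact hk
  have hgs : Function.Surjective g := (Submodule.mkQ_surjective _).comp hf
  rw [numGen, ← hg]
  exact ell_congr (g.quotKerEquivOfSurjective hgs)

theorem numGen_pi [IsArtinianRing R] (n : ℕ) : numGen R (Fin n → R) = n := by
  let g : (Fin n → R) →ₗ[R] (Fin n → κ) := (Algebra.linearMap R κ).compLeft (Fin n)
  have hgs : Function.Surjective g := fun y => by
    choose x hx using fun i => residue_surjective (y i)
    exact ⟨x, funext hx⟩
  have hg : LinearMap.ker g = 𝔪 • ⊤ := by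
    ext x
    rw [mem_smul_top_pi_iff, LinearMap.mem_ker, funext_iff]
    exact forall_congr' fun i => residue_eq_zero_iff (x i)
  rw [numGen, ← hg, ell_congr (g.quotKerEquivOfSurjective hgs), ell_pi, ell_residueField, mul_one]

/-- A surjection from a free module onto a module is a minimal cover as soon as its rank does not
exceed the number of generators. -/
theorem ker_le_smul_top_of_surjective [IsArtinianRing R] {X : Type*} [AddCommGroup X]
    [Module R X] {n : ℕ} (f : (Fin n → R) →ₗ[R] X) (hf : Function.Surjective f)
    (hn : n ≤ numGen R X) : LinearMap.ker f ≤ 𝔪 • ⊤ := by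
  have : Module.Finite R X := Module.Finite.of_surjective f hf
  let g : (Fin n → R) →ₗ[R] X ⧸ (𝔪 • ⊤ : Submodule R X) := (Submodule.mkQ _).comp f
  have hgs : Function.Surjective g := (Submodule.mkQ_surjective _).comp hf
  have hg : 𝔪 • ⊤ ≤ LinearMap.ker g := by
    rw [Submodule.smul_le]
    intro a ha x _
    rw [LinearMap.mem_ker, map_smul]
    exact smul_top_quotient_eq_zero ha _
  have h1 := ell_quotient_add_ell (LinearMap.ker g)
  rw [ell_congr (g.quotKerEquivOfSurjective hgs), ← numGen_add_ell_smul_top (Fin n → R), numGen_pi]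
    at h1
  change numGen R X + _ = _ at h1
  rw [Submodule.eq_of_le_of_ell_le hg (by omega)]
  exact fun x hx => by simp [g, LinearMap.mem_ker.mp hx]

theorem exists_surjective_ker_le [IsArtinianRing R] (X : Type*) [AddCommGroup X] [Module R X]
    [Module.Finite R X] : ∃ f : (Fin (numGen R X) → R) →ₗ[R] X, Function.Surjective f ∧
      LinearMap.ker f ≤ 𝔪 • ⊤ := by
  obtain ⟨e⟩ := exists_equiv_pi_residueField (R := R) (X ⧸ (𝔪 • ⊤ : Submodule R X))
    fun a ha => smul_top_quotient_eq_zero ha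
  change _ ≃ₗ[R] (Fin (numGen R X) → κ) at e
  choose x hx using fun i => Submodule.mkQ_surjective _ (e.symm (Pi.single i 1))
  have hs : Function.Surjective (Fintype.linearCombination R x) := by
    rw [← LinearMap.range_eq_top]
    apply span_eq_top_of_sup_smul_top
    rw [eq_top_iff]
    intro y _
    choose c hc using fun i => residue_surjective (e (Submodule.mkQ _ y) i)
    have : y - Fintype.linearCombination R x c ∈ (𝔪 • ⊤ : Submodule R X) := by
      rw [← Submodule.Quotient.mk_eq_zero, ← Submodule.mkQ_apply, map_sub, sub_eq_zero,
        Fintype.linearCombination_apply, map_sum]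
      apply e.injective
      rw [map_sum]
      conv_lhs => rw [pi_eq_sum_univ' (e _)]
      refine Finset.sum_congr rfl fun i _ => ?_
      rw [map_smul, map_smul, hx, e.apply_symm_apply, ← hc]
      ext j
      simp [Pi.single_apply, Algebra.smul_def]
    rw [← sub_add_cancel y (Fintype.linearCombination R x c), add_comm]
    exact Submodule.add_mem_sup ⟨c, rfl⟩ this
  exact ⟨_, hs, ker_le_smul_top_of_surjective _ hs le_rfl⟩

/-- A socle element that is part of a minimal generating set splits off a copy of the residue
field. -/
theorem exists_residueField_retract [IsArtinianRing R] {X : Type*} [AddCommGroup X] [Module R X]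
    [Module.Finite R X] {x : X} (hx : ∀ a ∈ 𝔪, a • x = 0) (hx' : x ∉ (𝔪 • ⊤ : Submodule R X)) :
    ∃ (i : κ →ₗ[R] X) (p : X →ₗ[R] κ), p ∘ₗ i = LinearMap.id := by
  obtain ⟨e⟩ := exists_equiv_pi_residueField (R := R) (X ⧸ (𝔪 • ⊤ : Submodule R X))
    fun a ha => smul_top_quotient_eq_zero ha
  have h0 : e (Submodule.mkQ _ x) ≠ 0 := by
    rwa [ne_eq, LinearEquiv.map_eq_zero_iff, Submodule.mkQ_apply, Submodule.Quotient.mk_eq_zero]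
  obtain ⟨j, hj⟩ := Function.ne_iff.mp h0
  obtain ⟨c, hc⟩ := residue_surjective (e (Submodule.mkQ _ x) j)⁻¹
  let i : κ →ₗ[R] X := Submodule.liftQ (𝔪 : Submodule R R) (LinearMap.toSpanSingleton R X x)
    fun a ha => by simpa using hx a ha
  let p : X →ₗ[R] κ := c • ((LinearMap.proj j).comp (e.toLinearMap.comp (Submodule.mkQ _)))
  have hi (a : R) : i (residue R a) = a • x := rfl
  refine ⟨i, p, LinearMap.ext fun y => ?_⟩
  obtain ⟨a, rfl⟩ := residue_surjective y
  rw [LinearMap.comp_apply, hi, map_smul]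
  have : p x = 1 := by
    simp only [p, LinearMap.smul_apply, Algebra.smul_def, ResidueField.algebraMap_eq, hc]
    exact inv_mul_cancel₀ hj
  rw [this, Algebra.smul_def, mul_one]
  rfl

theorem numGen_eq_spanFinrank [IsArtinianRing R] (X : Type*) [AddCommGroup X] [Module R X]
    [Module.Finite R X] : numGen R X = (⊤ : Submodule R X).spanFinrank := by
  rw [spanFinrank_eq_finrank_quotient _ Module.Finite.fg_top,
    ← numGen_congr (Submodule.topEquiv (R := R) (M := X)), numGen, ell,
    Module.length_eq_of_surjective (S := R) (R := R ⧸ 𝔪) Ideal.Quotient.mk_surjective]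
  let : Field (R ⧸ 𝔪) := Ideal.Quotient.field 𝔪
  rw [Module.length_eq_finrank (R ⧸ 𝔪)]
  rfl

end Residue

/-! ### Contravariant long exact sequences of Ext -/

section ExtLES

open Abelian

variable {R : Type u} [CommRing R]

/-- `Ext^i_R(X, Y)` for modules, without the coercions to the category of modules. -/
abbrev ExtM (R : Type u) [CommRing R] (X Y : Type u) [AddCommGroup X] [Module R X]
    [AddCommGroup Y] [Module R Y] (i : ℕ) : Type u :=
  Ext (ModuleCat.of R X) (ModuleCat.of R Y) i

variable {A B C : Type u} [AddCommGroup A] [Module R A] [AddCommGroup B] [Module R B]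
  [AddCommGroup C] [Module R C] (Y : Type u) [AddCommGroup Y] [Module R Y]

/-- The map `Ext^i(B, Y) → Ext^i(A, Y)` induced by `f : A → B`. -/
noncomputable def extMap (f : A →ₗ[R] B) (i : ℕ) : ExtM R B Y i →ₗ[R] ExtM R A Y i :=
  (Ext.mk₀ (ModuleCat.ofHom f)).precompOfLinear R (ModuleCat.of R Y) (zero_add i)

theorem extMap_apply (f : A →ₗ[R] B) (i : ℕ) (x : ExtM R B Y i) :
    extMap Y f i x = (Ext.mk₀ (ModuleCat.ofHom f)).comp x (zero_add i) := rfl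

theorem extMap_comp (f : A →ₗ[R] B) (g : B →ₗ[R] C) (i : ℕ) (x : ExtM R C Y i) :
    extMap Y (g ∘ₗ f) i x = extMap Y f i (extMap Y g i x) := by
  simp only [extMap_apply, Ext.mk₀_comp_mk₀_assoc, ModuleCat.ofHom_comp]

theorem extMap_id (i : ℕ) (x : ExtM R A Y i) : extMap Y (LinearMap.id : A →ₗ[R] A) i x = x := by
  rw [extMap_apply]
  exact Ext.mk₀_id_comp x

theorem extMap_zero (i : ℕ) : extMap Y (0 : A →ₗ[R] B) i = 0 := by
  ext x
  rw [extMap_apply]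
  have : ModuleCat.ofHom (0 : A →ₗ[R] B) = 0 := rfl
  rw [this, Ext.mk₀_zero, Ext.zero_comp]
  rfl

theorem subsingleton_ext_of_subsingleton [Subsingleton A] (i : ℕ) :
    Subsingleton (ExtM R A Y i) := by
  refine subsingleton_of_forall_eq 0 fun x => ?_
  rw [← extMap_id Y i x, Subsingleton.elim (LinearMap.id : A →ₗ[R] A) 0, extMap_zero]
  rfl

theorem subsingleton_ext_of_retract (i : A →ₗ[R] B) (p : B →ₗ[R] A) (h : p ∘ₗ i = LinearMap.id)
    (n : ℕ) [Subsingleton (ExtM R B Y n)] : Subsingleton (ExtM R A Y n) := by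
  refine subsingleton_of_forall_eq 0 fun x => ?_
  rw [← extMap_id Y n x, ← h, extMap_comp, Subsingleton.elim (extMap Y p n x) 0, map_zero]

theorem subsingleton_ext_of_projective [Module.Projective R A] (n : ℕ) :
    Subsingleton (ExtM R A Y (n + 1)) := by
  have : Projective (ModuleCat.of R A) := (IsProjective.iff_projective A).mp ‹_›
  exact subsingleton_of_forall_eq 0 fun x => Ext.eq_zero_of_projective x

/-- The equivalence `Ext^i(B, Y) ≃ Ext^i(A, Y)` induced by `e : A ≃ B`. -/
noncomputable def extCongr (e : A ≃ₗ[R] B) (i : ℕ) : ExtM R B Y i ≃ₗ[R] ExtM R A Y i :=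
  LinearEquiv.ofLinearMap (extMap Y e.toLinearMap i) (extMap Y e.symm.toLinearMap i)
    (LinearMap.ext fun x => by
      rw [LinearMap.comp_apply, ← extMap_comp]; simp [extMap_id])
    (LinearMap.ext fun x => by
      rw [LinearMap.comp_apply, ← extMap_comp]; simp [extMap_id])

variable (R) (A) in
/-- `Ext^0` is `Hom`. -/
noncomputable def extZeroEquiv : ExtM R A Y 0 ≃ₗ[R] (A →ₗ[R] Y) :=
  Ext.linearEquiv₀.trans ModuleCat.homLinearEquiv

theorem extZeroEquiv_extMap (f : A →ₗ[R] B) (x : ExtM R B Y 0) :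
    extZeroEquiv R A Y (extMap Y f 0 x) = extZeroEquiv R B Y x ∘ₗ f := by
  obtain ⟨g, rfl⟩ := (extZeroEquiv R B Y).symm.surjective x
  rw [LinearEquiv.apply_symm_apply, ← LinearEquiv.eq_symm_apply]
  change (Ext.mk₀ (ModuleCat.ofHom f)).comp (Ext.mk₀ (ModuleCat.ofHom g)) (zero_add 0) =
    Ext.mk₀ (ModuleCat.ofHom (g ∘ₗ f))
  rw [Ext.mk₀_comp_mk₀, ModuleCat.ofHom_comp]

/-- A short exact sequence of modules, with its maps as linear maps. -/
structure IsSES (f : A →ₗ[R] B) (g : B →ₗ[R] C) : Prop where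
  inj : Function.Injective f
  exact : Function.Exact f g
  surj : Function.Surjective g

variable {f : A →ₗ[R] B} {g : B →ₗ[R] C}

theorem IsSES.shortExact (h : IsSES f g) :
    (ModuleCat.shortComplexOfCompEqZero f g h.exact.linearMap_comp_eq_zero).ShortExact :=
  ModuleCat.shortComplex_shortExact _ h.exact h.inj h.surj

/-- The connecting map `Ext^i(A, Y) → Ext^{i+1}(C, Y)` of a short exact sequence
`0 → A → B → C → 0`. -/
noncomputable def IsSES.δ (h : IsSES f g) (i : ℕ) : ExtM R A Y i →ₗ[R] ExtM R C Y (i + 1) :=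
  h.shortExact.extClass.precompOfLinear R (ModuleCat.of R Y) (add_comm 1 i)

theorem IsSES.exact_mid (h : IsSES f g) (i : ℕ) :
    Function.Exact (extMap Y g i) (extMap Y f i) := by
  intro x
  constructor
  · exact fun hx => Ext.contravariant_sequence_exact₂ h.shortExact _ x hx
  · rintro ⟨y, rfl⟩
    rw [← extMap_comp, h.exact.linearMap_comp_eq_zero, extMap_zero]
    rfl

theorem IsSES.exact_left (h : IsSES f g) (i : ℕ) :
    Function.Exact (extMap Y f i) (h.δ Y i) := by
  intro x
  constructor
  · exact fun hx => Ext.contravariant_sequence_exact₁ h.shortExact _ x (add_comm 1 i) hx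
  · rintro ⟨y, rfl⟩
    exact h.shortExact.extClass_comp_assoc _ (h := add_comm 1 i)

theorem IsSES.exact_right (h : IsSES f g) (i : ℕ) :
    Function.Exact (h.δ Y i) (extMap Y g (i + 1)) := by
  intro x
  constructor
  · exact fun hx => Ext.contravariant_sequence_exact₃ h.shortExact _ x hx (add_comm 1 i)
  · rintro ⟨y, rfl⟩
    exact h.shortExact.comp_extClass_assoc _ (add_comm 1 i)

theorem extMap_zero_injective (hg : Function.Surjective g) :
    Function.Injective (extMap Y g 0) := by
  rw [injective_iff_map_eq_zero]
  intro x hx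
  apply (extZeroEquiv R C Y).injective
  have := extZeroEquiv_extMap Y g x
  rw [hx, map_zero] at this
  rw [map_zero]
  exact (LinearMap.cancel_right hg).mp (by rw [← this, LinearMap.zero_comp])

theorem extMap_zero_surjective (hf : ∀ φ : A →ₗ[R] Y, ∃ ψ : B →ₗ[R] Y, ψ ∘ₗ f = φ) :
    Function.Surjective (extMap Y f 0) := by
  intro x
  obtain ⟨ψ, hψ⟩ := hf (extZeroEquiv R A Y x)
  refine ⟨(extZeroEquiv R B Y).symm ψ, (extZeroEquiv R A Y).injective ?_⟩
  rw [extZeroEquiv_extMap, LinearEquiv.apply_symm_apply, hψ]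

theorem IsSES.exists_extend (h : IsSES f g) [Subsingleton (ExtM R C Y 1)] (φ : A →ₗ[R] Y) :
    ∃ ψ : B →ₗ[R] Y, ψ ∘ₗ f = φ := by
  obtain ⟨x, hx⟩ := (h.exact_left Y 0 ((extZeroEquiv R A Y).symm φ)).mp (Subsingleton.elim _ _)
  exact ⟨extZeroEquiv R B Y x, by rw [← extZeroEquiv_extMap, hx, LinearEquiv.apply_symm_apply]⟩

/-- Naturality of the connecting map. -/
theorem IsSES.extMap_δ {A' B' C' : Type u} [AddCommGroup A'] [Module R A'] [AddCommGroup B']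
    [Module R B'] [AddCommGroup C'] [Module R C'] {f' : A' →ₗ[R] B'} {g' : B' →ₗ[R] C'}
    (h : IsSES f g) (h' : IsSES f' g') (a : A →ₗ[R] A') (b : B →ₗ[R] B') (c : C →ₗ[R] C')
    (hab : f' ∘ₗ a = b ∘ₗ f) (hbc : g' ∘ₗ b = c ∘ₗ g) (i : ℕ) (x : ExtM R A' Y i) :
    extMap Y c (i + 1) (h'.δ Y i x) = h.δ Y i (extMap Y a i x) := by
  let φ : ModuleCat.shortComplexOfCompEqZero f g h.exact.linearMap_comp_eq_zero ⟶
      ModuleCat.shortComplexOfCompEqZero f' g' h'.exact.linearMap_comp_eq_zero :=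
    { τ₁ := ModuleCat.ofHom a
      τ₂ := ModuleCat.ofHom b
      τ₃ := ModuleCat.ofHom c
      comm₁₂ := ModuleCat.hom_ext hab
      comm₂₃ := ModuleCat.hom_ext hbc }
  have := ShortComplex.ShortExact.extClass_naturality h.shortExact h'.shortExact φ
  change (Ext.mk₀ φ.τ₃).comp (h'.shortExact.extClass.comp x (add_comm 1 i)) (zero_add _) =
    h.shortExact.extClass.comp ((Ext.mk₀ φ.τ₁).comp x (zero_add i)) (add_comm 1 i)
  rw [← Ext.comp_assoc (a₁₂ := 1) _ _ _ (by lia) (by lia) (by lia), ← this,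
    Ext.comp_assoc (a₂₃ := i) _ _ _ (by lia) (by lia) (by lia)]

/-- Dimension shift along `0 → A → B → C → 0` in degrees where `B` has no cohomology. -/
theorem IsSES.δ_bijective (h : IsSES f g) (i : ℕ) [Subsingleton (ExtM R B Y (i + 1))]
    (h0 : extMap Y f i = 0) : Function.Bijective (h.δ Y i) := by
  constructor
  · rw [injective_iff_map_eq_zero]
    intro x hx
    obtain ⟨y, rfl⟩ := (h.exact_left Y i x).mp hx
    rw [h0, LinearMap.zero_apply]
  · exact fun x => (h.exact_right Y i x).mp (Subsingleton.elim _ _)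

theorem extMap_eq_zero_of_subsingleton (f : A →ₗ[R] B) (i : ℕ) [Subsingleton (ExtM R B Y i)] :
    extMap Y f i = 0 :=
  LinearMap.ext fun x => by rw [Subsingleton.elim x 0, map_zero, map_zero]

theorem IsSES.subsingleton_ext (h : IsSES f g) (i : ℕ) [Subsingleton (ExtM R A Y i)]
    [Subsingleton (ExtM R B Y (i + 1))] : Subsingleton (ExtM R C Y (i + 1)) := by
  refine subsingleton_of_forall_eq 0 fun x => ?_
  obtain ⟨y, rfl⟩ := (h.exact_right Y i x).mp (Subsingleton.elim _ _)
  rw [Subsingleton.elim y 0, map_zero]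

end ExtLES

/-! ### Lengths of Ext modules -/

section ExtLength

variable {R : Type u} [CommRing R]
variable {A B C : Type u} [AddCommGroup A] [Module R A] [AddCommGroup B] [Module R B]
  [AddCommGroup C] [Module R C] (Y : Type u) [AddCommGroup Y] [Module R Y]

instance finite_extM [IsNoetherianRing R] [Module.Finite R A] [Module.Finite R Y] (i : ℕ) :
    Module.Finite R (ExtM R A Y i) :=
  ModuleCat.finite_ext R (ModuleCat.of R A) (ModuleCat.of R Y) i

theorem isSES_prod : IsSES (LinearMap.inl R A B) (LinearMap.snd R A B) :=
  ⟨LinearMap.inl_injective, .inl_snd, LinearMap.snd_surjective⟩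

theorem isSES_subtype_mkQ (N : Submodule R A) : IsSES N.subtype N.mkQ :=
  ⟨N.injective_subtype, LinearMap.exact_subtype_mkQ N, N.mkQ_surjective⟩

theorem isSES_ker {f : A →ₗ[R] B} (hf : Function.Surjective f) :
    IsSES (LinearMap.ker f).subtype f :=
  ⟨Submodule.injective_subtype _, LinearMap.exact_subtype_ker_map f, hf⟩

theorem extMap_leftInverse {f : A →ₗ[R] B} {g : B →ₗ[R] A} (h : g ∘ₗ f = LinearMap.id) (i : ℕ)
    (x : ExtM R A Y i) : extMap Y f i (extMap Y g i x) = x := by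
  rw [← extMap_comp, h, extMap_id]

variable [IsArtinianRing R]

theorem ell_ext_prod [Module.Finite R A] [Module.Finite R B] [Module.Finite R Y] (i : ℕ) :
    ell R (ExtM R (A × B) Y i) = ell R (ExtM R A Y i) + ell R (ExtM R B Y i) := by
  rw [add_comm]
  refine ell_eq_add_of_exact (extMap Y (LinearMap.snd R A B) i) (extMap Y (LinearMap.inl R A B) i)
    ?_ ?_ (isSES_prod.exact_mid Y i)
  · exact Function.LeftInverse.injective (g := extMap Y (LinearMap.inr R A B) i)
      (extMap_leftInverse Y (LinearMap.snd_comp_inr R A B) i)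
  · exact Function.RightInverse.surjective (g := extMap Y (LinearMap.fst R A B) i)
      (extMap_leftInverse Y (LinearMap.fst_comp_inl R A B) i)

theorem ell_ext_pi [Module.Finite R A] [Module.Finite R Y] (n i : ℕ) :
    ell R (ExtM R (Fin n → A) Y i) = n * ell R (ExtM R A Y i) := by
  induction n with
  | zero =>
    have := subsingleton_ext_of_subsingleton (R := R) (A := Fin 0 → A) Y i
    rw [ell_of_subsingleton, zero_mul]
  | succ n ih =>
    rw [ell_congr (extCongr Y (Fin.consLinearEquiv R (fun _ => A)) i), ell_ext_prod, ih]
    ring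

variable [IsLocalRing R]

local notation "𝔪" => maximalIdeal R
local notation "κ" => ResidueField R

theorem ell_ext_of_smul_eq_zero (V : Type u) [AddCommGroup V] [Module R V] [Module.Finite R V]
    [Module.Finite R Y] (h : ∀ a ∈ 𝔪, ∀ v : V, a • v = 0) (i : ℕ) :
    ell R (ExtM R V Y i) = ell R V * ell R (ExtM R κ Y i) := by
  obtain ⟨e⟩ := exists_equiv_pi_residueField V h
  rw [← ell_congr (extCongr Y e i), ell_ext_pi]

theorem ell_hom_of_smul_eq_zero (V : Type u) [AddCommGroup V] [Module R V] [Module.Finite R V]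
    [Module.Finite R Y] (h : ∀ a ∈ 𝔪, ∀ v : V, a • v = 0) :
    ell R (V →ₗ[R] Y) = ell R V * ell R (κ →ₗ[R] Y) := by
  rw [← ell_congr (extZeroEquiv R V Y), ← ell_congr (extZeroEquiv R κ Y),
    ell_ext_of_smul_eq_zero Y V h]

/-- Maps to the residue field only see `A / 𝔪 A`. -/
theorem ell_hom_residueField [Module.Finite R A] : ell R (A →ₗ[R] κ) = numGen R A := by
  have h0 (φ : A →ₗ[R] κ) : (𝔪 • ⊤ : Submodule R A) ≤ LinearMap.ker φ := by
    rw [Submodule.smul_le]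
    intro a ha x _
    rw [LinearMap.mem_ker, map_smul, smul_residueField_eq_zero ha]
  have h1 : ell R (κ →ₗ[R] κ) = 1 := by
    let e : (κ →ₗ[R] κ) ≃ₗ[R] κ :=
      { toFun := fun φ => φ 1
        map_add' := fun _ _ => rfl
        map_smul' := fun _ _ => rfl
        invFun := fun x => LinearMap.mulLeft R x
        left_inv := fun φ => by
          ext y
          obtain ⟨a, rfl⟩ := residue_surjective y
          have : residue R a = a • (1 : κ) := by rw [Algebra.smul_def, mul_one]; rfl
          rw [this, map_smul, map_smul]
          simp
        right_inv := fun x => by simp }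
    rw [ell_congr e, ell_residueField]
  let e : ((A ⧸ (𝔪 • ⊤ : Submodule R A)) →ₗ[R] κ) ≃ₗ[R] (A →ₗ[R] κ) :=
    { toFun := fun φ => φ ∘ₗ Submodule.mkQ _
      map_add' := fun _ _ => rfl
      map_smul' := fun _ _ => rfl
      invFun := fun φ => Submodule.liftQ _ φ (h0 φ)
      left_inv := fun φ => by ext; rfl
      right_inv := fun φ => by ext; rfl }
  rw [← ell_congr e, ell_hom_of_smul_eq_zero _ _ fun a ha => smul_top_quotient_eq_zero ha, h1,
    mul_one]
  rfl

/-- Half-exactness of `Ext^1(-, Y)`, along a composition series of `X`. -/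
theorem subsingleton_ext_one_of_residueField [Subsingleton (ExtM R κ Y 1)]
    (X : Type u) [AddCommGroup X] [Module R X] [Module.Finite R X] :
    Subsingleton (ExtM R X Y 1) := by
  have hX : IsFiniteLength R X :=
    isFiniteLength_iff_isNoetherian_isArtinian.mpr ⟨inferInstance, inferInstance⟩
  induction hX with
  | of_subsingleton => exact subsingleton_ext_of_subsingleton Y 1
  | @of_simple_quotient M _ _ N hN _ ih =>
    obtain ⟨I, hI, ⟨e⟩⟩ := isSimpleModule_iff_quot_maximal.mp hN
    rw [eq_maximalIdeal hI] at e
    let e' : (M ⧸ N) ≃ₗ[R] κ := e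
    have h1 : Subsingleton (ExtM R (M ⧸ N) Y 1) :=
      (extCongr Y e' 1).symm.toEquiv.subsingleton
    refine subsingleton_of_forall_eq 0 fun x => ?_
    obtain ⟨y, rfl⟩ := ((isSES_subtype_mkQ N).exact_mid Y 1 x).mp (Subsingleton.elim _ _)
    rw [Subsingleton.elim y 0, map_zero]

/-- If `Ext^1(κ, R) = 0` then `R` is self-injective, by Baer's criterion. -/
theorem isGorensteinLocalRing_of_subsingleton_ext_one [IsNoetherianRing R]
    [Subsingleton (ExtM R κ R 1)] : IsGorensteinLocalRing R := by
  have hb : Module.Baer R R := fun I g => by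
    have := subsingleton_ext_one_of_residueField (R := R) R (R ⧸ I)
    obtain ⟨ψ, hψ⟩ := (isSES_subtype_mkQ (I : Submodule R R)).exists_extend R g
    exact ⟨ψ, fun x hx => by rw [← hψ]; rfl⟩
  have : Module.Injective R R := hb.injective
  have : Injective (ModuleCat.of R R) := (Module.injective_iff_injective_object R R).mp this
  exact ⟨1, inferInstance⟩

end ExtLength

/-! ### Modules of G-dimension zero -/

section GDimension

variable {R : Type u} [CommRing R]

/-- Direct summands of modules of G-dimension zero have G-dimension zero. -/
theorem HasGDimensionZero.of_retract {M N : Type u} [AddCommGroup M] [Module R M] [AddCommGroup N]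
    [Module R N] (h : HasGDimensionZero R M) (i : N →ₗ[R] M) (p : M →ₗ[R] N)
    (hpi : p ∘ₗ i = LinearMap.id) : HasGDimensionZero R N := by
  have hpi' (x : N) : p (i x) = x := LinearMap.congr_fun hpi x
  refine ⟨⟨?_, ?_⟩, fun n hn => ?_, fun n hn => ?_⟩
  · intro x y hxy
    have : i x = i y := h.bijective_eval.1 <| LinearMap.ext fun φ =>
      LinearMap.congr_fun hxy (φ ∘ₗ i)
    rw [← hpi' x, this, hpi']
  · intro φ
    obtain ⟨m, hm⟩ := h.bijective_eval.2 (φ ∘ₗ i.dualMap)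
    refine ⟨p m, LinearMap.ext fun f => ?_⟩
    have := LinearMap.congr_fun hm (f ∘ₗ p)
    change f (p m) = φ (f ∘ₗ p ∘ₗ i) at this
    rwa [hpi, LinearMap.comp_id] at this
  · have := h.ext_eq_zero n hn
    exact subsingleton_ext_of_retract (A := N) (B := M) R i p hpi n
  · have := h.ext_dual_eq_zero n hn
    refine subsingleton_ext_of_retract (A := Module.Dual R N) (B := Module.Dual R M) R
      p.dualMap i.dualMap (LinearMap.ext fun f => ?_) n
    change f ∘ₗ p ∘ₗ i = f
    rw [hpi, LinearMap.comp_id]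

theorem HasGDimensionZero.dual {M : Type u} [AddCommGroup M] [Module R M]
    (h : HasGDimensionZero R M) : HasGDimensionZero R (Module.Dual R M) := by
  let e : M ≃ₗ[R] Module.Dual R (Module.Dual R M) := LinearEquiv.ofBijective _ h.bijective_eval
  refine ⟨⟨?_, ?_⟩, h.ext_dual_eq_zero, fun n hn => ?_⟩
  · intro f g hfg
    exact LinearMap.ext fun x => LinearMap.congr_fun hfg (Module.Dual.eval R M x)
  · intro φ
    refine ⟨φ ∘ₗ Module.Dual.eval R M, LinearMap.ext fun ψ => ?_⟩
    obtain ⟨x, rfl⟩ := h.bijective_eval.2 ψ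
    rfl
  · have := h.ext_eq_zero n hn
    exact subsingleton_ext_of_retract (A := Module.Dual R (Module.Dual R M)) (B := M) R
      e.symm.toLinearMap e.toLinearMap (LinearMap.ext fun x => e.apply_symm_apply x) n

theorem IsSES.dual {A B C : Type u} [AddCommGroup A] [Module R A] [AddCommGroup B] [Module R B]
    [AddCommGroup C] [Module R C] {f : A →ₗ[R] B} {g : B →ₗ[R] C} (h : IsSES f g)
    [Subsingleton (ExtM R C R 1)] : IsSES g.dualMap f.dualMap := by
  refine ⟨LinearMap.dualMap_injective_of_surjective h.surj, fun φ => ⟨fun hφ => ?_, ?_⟩,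
    fun φ => h.exists_extend R φ⟩
  · change φ ∈ LinearMap.range g.dualMap
    rw [LinearMap.range_dualMap_eq_dualAnnihilator_ker_of_surjective g h.surj,
      Submodule.mem_dualAnnihilator]
    intro x hx
    obtain ⟨y, rfl⟩ := (h.exact x).mp hx
    exact LinearMap.congr_fun hφ y
  · rintro ⟨ψ, rfl⟩
    exact LinearMap.ext fun x => by
      change ψ (g (f x)) = 0
      rw [h.exact.apply_apply_eq_zero, map_zero]

/-- The syzygy of a module of G-dimension zero has G-dimension zero. -/
theorem HasGDimensionZero.ker {M : Type u} [AddCommGroup M] [Module R M]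
    (h : HasGDimensionZero R M) {n : ℕ} {π : (Fin n → R) →ₗ[R] M} (hπ : Function.Surjective π) :
    HasGDimensionZero R (LinearMap.ker π) := by
  have hs := isSES_ker hπ
  have h1 : Subsingleton (ExtM R M R 1) := h.ext_eq_zero 1 one_pos
  have hd := hs.dual
  have hF : Function.Bijective (Module.Dual.eval R (Fin n → R)) := Module.bijective_dual_eval R _
  refine ⟨⟨?_, ?_⟩, ?_, ?_⟩
  · intro x y hxy
    exact Subtype.ext <| hF.1 <| LinearMap.ext fun φ =>
      LinearMap.congr_fun hxy (φ ∘ₗ (LinearMap.ker π).subtype)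
  · intro φ
    obtain ⟨y, hy⟩ := hF.2 (φ ∘ₗ (LinearMap.ker π).subtype.dualMap)
    have hy' : π y = 0 := h.bijective_eval.1 <| LinearMap.ext fun f => by
      have := LinearMap.congr_fun hy (f ∘ₗ π)
      change f (π y) = φ _ at this
      have h0 : (LinearMap.ker π).subtype.dualMap (f ∘ₗ π) = 0 :=
        LinearMap.ext fun z => by
          change f (π z) = 0
          rw [LinearMap.mem_ker.mp z.2, map_zero]
      rw [h0, map_zero] at this
      simpa using this
    refine ⟨⟨y, hy'⟩, LinearMap.ext fun f => ?_⟩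
    obtain ⟨g, rfl⟩ := hd.surj f
    exact LinearMap.congr_fun hy g
  · intro i hi
    obtain ⟨i, rfl⟩ := Nat.exists_eq_add_of_lt hi
    rw [zero_add]
    have hM : Subsingleton (ExtM R M R (i + 1 + 1)) := h.ext_eq_zero _ (by omega)
    have hP := subsingleton_ext_of_projective (R := R) (A := Fin n → R) R i
    refine subsingleton_of_forall_eq 0 fun x => ?_
    obtain ⟨y, rfl⟩ := (hs.exact_left R (i + 1) x).mp (Subsingleton.elim _ _)
    rw [Subsingleton.elim y 0, map_zero]
  · intro i hi
    obtain ⟨i, rfl⟩ := Nat.exists_eq_add_of_lt hi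
    rw [zero_add]
    have hP := subsingleton_ext_of_projective (R := R) (A := Module.Dual R (Fin n → R)) R i
    obtain _ | i := i
    · refine subsingleton_of_forall_eq 0 fun x => ?_
      obtain ⟨y, rfl⟩ := (hd.exact_right R 0 x).mp (Subsingleton.elim _ _)
      refine (hd.exact_left R 0 y).mpr (extMap_zero_surjective R (fun φ => ?_) y)
      obtain ⟨m, rfl⟩ := h.bijective_eval.2 φ
      obtain ⟨y, rfl⟩ := hπ m
      exact ⟨Module.Dual.eval R _ y, rfl⟩
    · have : Subsingleton (ExtM R (Module.Dual R M) R (i + 1)) := h.ext_dual_eq_zero _ (by omega)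
      exact hd.subsingleton_ext R (i + 1)

variable [IsLocalRing R]

local notation "𝔪" => maximalIdeal R
local notation "κ" => ResidueField R

/-- A module of G-dimension zero all of whose functionals take values in the maximal ideal.  Over a
local ring the second condition says that the module has no nonzero free direct summand. -/
structure IsStableGZero (R : Type u) [CommRing R] [IsLocalRing R] (M : Type u) [AddCommGroup M]
    [Module R M] : Prop where
  gdim : HasGDimensionZero R M
  apply_mem : ∀ (f : Module.Dual R M) (x : M), f x ∈ maximalIdeal R

theorem IsStableGZero.dual {M : Type u} [AddCommGroup M] [Module R M] (h : IsStableGZero R M) :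
    IsStableGZero R (Module.Dual R M) := by
  refine ⟨h.gdim.dual, fun φ f => ?_⟩
  obtain ⟨x, rfl⟩ := h.gdim.bijective_eval.2 φ
  exact h.apply_mem f x

theorem IsStableGZero.ker {M : Type u} [AddCommGroup M] [Module R M] (h : IsStableGZero R M)
    {n : ℕ} {π : (Fin n → R) →ₗ[R] M} (hπ : Function.Surjective π)
    (hk : LinearMap.ker π ≤ 𝔪 • ⊤) : IsStableGZero R (LinearMap.ker π) := by
  refine ⟨h.gdim.ker hπ, fun f x => ?_⟩
  have h1 : Subsingleton (ExtM R M R 1) := h.gdim.ext_eq_zero 1 one_pos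
  obtain ⟨ψ, rfl⟩ := (isSES_ker hπ).exists_extend R f
  have : (𝔪 • ⊤ : Submodule R (Fin n → R)) ≤ Submodule.comap ψ 𝔪 := by
    rw [Submodule.smul_le]
    intro a ha y _
    rw [Submodule.mem_comap, map_smul]
    exact Ideal.mul_mem_right _ _ ha
  exact this (hk x.2)

/-- If `𝔪³ = 0`, then a module of G-dimension zero without free summand is killed by `𝔪²`, because
functionals separate its points. -/
theorem IsStableGZero.smul_smul_eq_zero {M : Type u} [AddCommGroup M] [Module R M]
    (h : IsStableGZero R M) (h3 : 𝔪 ^ 3 = ⊥) {a : R} (ha : a ∈ 𝔪 ^ 2) (x : M) : a • x = 0 := by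
  apply h.gdim.bijective_eval.1
  refine LinearMap.ext fun f => ?_
  simp only [Module.Dual.eval_apply, map_zero, map_smul, smul_eq_mul, LinearMap.smul_apply]
  change a * f x = 0
  rw [← Ideal.mem_bot, ← h3, pow_succ]
  exact Ideal.mul_mem_mul ha (h.apply_mem f x)

theorem exists_apply_eq_one_of_not_mem {M : Type*} [AddCommGroup M] [Module R M]
    {f : Module.Dual R M} {x : M} (h : f x ∉ 𝔪) : ∃ y, f y = 1 := by
  obtain ⟨u, hu⟩ := (notMem_maximalIdeal.mp h)
  exact ⟨(u⁻¹ : Rˣ).1 • x, by rw [map_smul, ← hu, smul_eq_mul, Units.inv_mul]⟩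

/-- A functional with an invertible value splits off a copy of `R`. -/
theorem HasNoFreeSummand.apply_mem {M : Type*} [AddCommGroup M] [Module R M]
    (h : HasNoFreeSummand R M) (f : Module.Dual R M) (x : M) : f x ∈ 𝔪 := by
  by_contra hx
  obtain ⟨y, hy⟩ := exists_apply_eq_one_of_not_mem hx
  let N : Submodule R M := LinearMap.range (LinearMap.toSpanSingleton R M y)
  have hinj : Function.Injective (LinearMap.toSpanSingleton R M y) := by
    intro a b hab
    simpa [hy] using congrArg f hab
  have hc : IsCompl N (LinearMap.ker f) := by
    constructor
    · rw [Submodule.disjoint_def]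
      rintro _ ⟨a, rfl⟩ ha
      have : a = 0 := by simpa [hy] using ha
      rw [this, map_zero]
    · rw [codisjoint_iff, eq_top_iff]
      intro z _
      rw [← add_sub_cancel (f z • y) z]
      exact Submodule.add_mem_sup ⟨f z, by simp⟩ (by simp [hy])
  have h0 := h N _ hc (Module.Free.of_equiv (LinearEquiv.ofInjective _ hinj))
  have : y ∈ N := ⟨1, by simp⟩
  rw [h0, Submodule.mem_bot] at this
  rw [this, map_zero] at hy
  exact zero_ne_one hy

/-- Splitting off free summands as long as possible. -/
theorem exists_equiv_free_prod [IsArtinianRing R] (M : Type u) [AddCommGroup M] [Module R M]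
    [Module.Finite R M] : ∃ (n : ℕ) (N : Type u) (_ : AddCommGroup N) (_ : Module R N),
      Module.Finite R N ∧ (∀ (f : Module.Dual R N) (x : N), f x ∈ 𝔪) ∧
        Nonempty (M ≃ₗ[R] (Fin n → R) × N) := by
  induction hl : ell R M using Nat.strong_induction_on generalizing M with
  | _ l ih =>
  subst hl
  by_cases hM : ∀ (f : Module.Dual R M) (x : M), f x ∈ 𝔪
  · exact ⟨0, M, _, _, inferInstance, hM, ⟨LinearEquiv.uniqueProd.symm⟩⟩
  · push Not at hM
    obtain ⟨f, x, hx⟩ := hM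
    obtain ⟨y, hy⟩ := exists_apply_eq_one_of_not_mem hx
    have hfs : Function.Surjective f := fun a => ⟨a • y, by simp [hy]⟩
    have hlt : ell R (LinearMap.ker f) < ell R M := by
      rw [← ell_quotient_add_ell (LinearMap.ker f), ell_congr (f.quotKerEquivOfSurjective hfs)]
      have := ell_pos (R := R) (X := R)
      omega
    obtain ⟨n, N, _, _, hN, hN', ⟨e⟩⟩ := ih _ hlt (LinearMap.ker f) rfl
    let e₁ : M ≃ₗ[R] R × LinearMap.ker f :=
      { toFun := fun z => (f z, ⟨z - f z • y, by simp [hy]⟩)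
        map_add' := fun a b => by
          ext
          · simp
          · simp only [map_add, add_smul, Prod.snd_add, Submodule.coe_add]; abel
        map_smul' := fun a b => by
          ext
          · simp
          · simp [smul_sub, mul_smul]
        invFun := fun z => z.1 • y + z.2
        left_inv := fun z => by simp
        right_inv := fun z => by
          have := LinearMap.mem_ker.mp z.2.2
          ext <;> simp [hy, this] }
    let e₂ : (R × (Fin n → R)) ≃ₗ[R] (Fin (n + 1) → R) := Fin.consLinearEquiv R (fun _ => R)
    exact ⟨n + 1, N, _, _, hN, hN', ⟨e₁.trans (((LinearEquiv.refl R R).prodCongr e).trans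
      ((LinearEquiv.prodAssoc R R (Fin n → R) N).symm.trans
        (e₂.prodCongr (LinearEquiv.refl R N))))⟩⟩

theorem HasGDimensionZero.exists_equiv_free_prod [IsArtinianRing R] {M : Type u} [AddCommGroup M]
    [Module R M] [Module.Finite R M] (h : HasGDimensionZero R M) :
    ∃ (n : ℕ) (N : Type u) (_ : AddCommGroup N) (_ : Module R N),
      Module.Finite R N ∧ IsStableGZero R N ∧ Nonempty (M ≃ₗ[R] (Fin n → R) × N) := by
  obtain ⟨n, N, _, _, hN, hN', ⟨e⟩⟩ := _root_.exists_equiv_free_prod (R := R) M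
  refine ⟨n, N, _, _, hN, ⟨h.of_retract (e.symm.toLinearMap ∘ₗ LinearMap.inr R _ _)
    (LinearMap.snd R _ _ ∘ₗ e.toLinearMap) (LinearMap.ext fun x => ?_), hN'⟩, ⟨e⟩⟩
  simp

end GDimension

/-! ### Numbers of generators of dual and syzygy -/

section Numerics

variable {R : Type u} [CommRing R] [IsLocalRing R]

local notation "𝔪" => maximalIdeal R
local notation "κ" => ResidueField R

theorem IsStableGZero.smul_smul_top_eq_zero {M : Type u} [AddCommGroup M] [Module R M]
    (h : IsStableGZero R M) (h3 : 𝔪 ^ 3 = ⊥) :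
    ∀ a ∈ 𝔪, ∀ v : (𝔪 • ⊤ : Submodule R M), a • v = 0 := by
  rintro a ha ⟨v, hv⟩
  refine Subtype.ext ?_
  change a • v = 0
  induction hv using Submodule.smul_induction_on' with
  | smul b hb x _ =>
    rw [smul_smul]
    exact h.smul_smul_eq_zero h3 (by rw [pow_two]; exact Ideal.mul_mem_mul ha hb) x
  | add x _ y _ hx hy => rw [smul_add, hx, hy, add_zero]

variable [IsArtinianRing R]

/-- As `Ext(M, R) = 0` in positive degrees, the connecting map
`Ext^{i+1}(𝔪 M, R) → Ext^{i+2}(M / 𝔪 M, R)` is bijective; both `𝔪 M` and `M / 𝔪 M` are sums of copies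
of `κ`. -/
theorem IsStableGZero.ext_ratio {M : Type u} [AddCommGroup M] [Module R M] [Module.Finite R M]
    (h : IsStableGZero R M) (h3 : 𝔪 ^ 3 = ⊥) (i : ℕ) :
    ell R (𝔪 • ⊤ : Submodule R M) * ell R (ExtM R κ R (i + 1)) =
      numGen R M * ell R (ExtM R κ R (i + 1 + 1)) := by
  have hs := isSES_subtype_mkQ (𝔪 • ⊤ : Submodule R M)
  have h1 : Subsingleton (ExtM R M R (i + 1)) := h.gdim.ext_eq_zero (i + 1) i.succ_pos
  have h2 : Subsingleton (ExtM R M R (i + 1 + 1)) := h.gdim.ext_eq_zero (i + 1 + 1) (i + 1).succ_pos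
  have h4 := hs.δ_bijective R (i + 1) (extMap_eq_zero_of_subsingleton R _ _)
  have h5 := ell_congr (LinearEquiv.ofBijective _ h4)
  rwa [ell_ext_of_smul_eq_zero R _ (h.smul_smul_top_eq_zero h3),
    ell_ext_of_smul_eq_zero R (M ⧸ (𝔪 • ⊤ : Submodule R M))
      fun a ha => smul_top_quotient_eq_zero ha] at h5

/-- The lengths in
`0 → Hom(M / 𝔪 M, R) → M* → Hom(𝔪 M, R) → Ext^1(M / 𝔪 M, R) → 0`. -/
theorem IsStableGZero.ell_dual {M : Type u} [AddCommGroup M] [Module R M] [Module.Finite R M]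
    (h : IsStableGZero R M) (h3 : 𝔪 ^ 3 = ⊥) :
    ell R (Module.Dual R M) + numGen R M * ell R (ExtM R κ R 1) =
      (numGen R M + ell R (𝔪 • ⊤ : Submodule R M)) * ell R (κ →ₗ[R] R) := by
  have hs := isSES_subtype_mkQ (𝔪 • ⊤ : Submodule R M)
  have h1 : Subsingleton (ExtM R M R (0 + 1)) := h.gdim.ext_eq_zero _ (by omega)
  have hδ : Function.Surjective (hs.δ R 0) :=
    fun x => (hs.exact_right R 0 x).mp (Subsingleton.elim _ _)
  have e1 := ell_ker_add_ell_range (hs.δ R 0)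
  have e2 := ell_ker_add_ell_range (extMap R (𝔪 • ⊤ : Submodule R M).subtype 0)
  rw [LinearMap.exact_iff.mp (hs.exact_left R 0), LinearMap.range_eq_top.mpr hδ,
    ell_congr Submodule.topEquiv, ell_congr (extZeroEquiv R _ R),
    ell_hom_of_smul_eq_zero R _ (h.smul_smul_top_eq_zero h3),
    ell_ext_of_smul_eq_zero R _ fun a ha => smul_top_quotient_eq_zero ha] at e1
  rw [LinearMap.exact_iff.mp (hs.exact_mid R 0), ell_congr (extZeroEquiv R M R),
    ← ell_congr (LinearEquiv.ofInjective _ (extMap_zero_injective R hs.surj)),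
    ell_congr (extZeroEquiv R _ R),
    ell_hom_of_smul_eq_zero R _ fun a ha => smul_top_quotient_eq_zero ha] at e2
  change _ + numGen R M * _ = _ at e1
  change numGen R M * _ + _ = ell R (Module.Dual R M) at e2
  rw [add_mul]
  linarith

theorem ext_one_pos [IsNoetherianRing R] (hG : ¬ IsGorensteinLocalRing R) :
    0 < ell R (ExtM R κ R 1) := by
  rw [Nat.pos_iff_ne_zero, ne_eq, ell_eq_zero_iff]
  exact fun _ => hG isGorensteinLocalRing_of_subsingleton_ext_one

/-- The quotient of the length of `𝔪 M` by the number of generators of `M` is the same for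
all stable `M`, namely the quotient of the lengths of `Ext^2(κ, R)` and `Ext^1(κ, R)`. -/
theorem IsStableGZero.ratio [IsNoetherianRing R] {M N : Type u} [AddCommGroup M] [Module R M]
    [Module.Finite R M] [AddCommGroup N] [Module R N] [Module.Finite R N]
    (hM : IsStableGZero R M) (hN : IsStableGZero R N) (h3 : 𝔪 ^ 3 = ⊥)
    (hG : ¬ IsGorensteinLocalRing R) :
    ell R (𝔪 • ⊤ : Submodule R M) * numGen R N = numGen R M * ell R (𝔪 • ⊤ : Submodule R N) := by
  have h1 := hM.ext_ratio h3 0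
  have h2 := hN.ext_ratio h3 0
  refine Nat.eq_of_mul_eq_mul_right (ext_one_pos hG) ?_
  linear_combination numGen R N * h1 - numGen R M * h2

/-- The dual of the cover `F → M` embeds `M*` into `𝔪 F*`, so that `F*` is a minimal cover of the
dual of the syzygy. -/
theorem numGen_dual_ker {M : Type u} [AddCommGroup M] [Module R M]
    (h : IsStableGZero R M) {n : ℕ} {π : (Fin n → R) →ₗ[R] M} (hπ : Function.Surjective π) :
    numGen R (Module.Dual R (LinearMap.ker π)) = n := by
  have h1 : Subsingleton (ExtM R M R 1) := h.gdim.ext_eq_zero 1 one_pos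
  have hd := (isSES_ker hπ).dual
  let e : Module.Dual R (Fin n → R) ≃ₗ[R] (Fin n → R) := (Pi.basisFun R (Fin n)).constr R |>.symm
  rw [← numGen_eq_of_surjective _ hd.surj, numGen_congr e, numGen_pi]
  rw [LinearMap.exact_iff.mp hd.exact]
  rintro _ ⟨f, rfl⟩
  have : e (π.dualMap f) ∈ (𝔪 • ⊤ : Submodule R (Fin n → R)) :=
    mem_smul_top_pi_iff.mpr fun i => h.apply_mem f _
  simpa using Submodule.smul_top_le_comap_smul_top 𝔪 e.symm.toLinearMap this

/-- Arithmetic for `numGen_ker_eq_numGen_dual`: if `(b', c')`, `(b, cN)` and `(d, cD)` are proportional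
to `(b, c)`, then an equality of total sums forces `b' = d`. -/
theorem eq_of_proportional {b c b' c' cN d cD : ℕ} (hb : 0 < b) (h1 : c * b' = b * c')
    (h2 : c * b = b * cN) (h3 : c * d = b * cD)
    (h : (b + c) + (b' + c') = (b + cN) + (d + cD)) : b' = d := by
  have h4 : c = cN := Nat.eq_of_mul_eq_mul_left hb (by linarith)
  subst h4
  have h5 : b' + c' = d + cD := by omega
  refine Nat.eq_of_mul_eq_mul_right (show 0 < b + c by omega) ?_
  linear_combination b * h5 + h1 - h3

/-- Compare the lengths in `0 → K → F → M → 0` and in its dual `0 → M* → F* → K* → 0`, whose middle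
terms are isomorphic, using `numGen_dual_ker` and the constant ratio. -/
theorem IsStableGZero.numGen_ker_eq_numGen_dual [IsNoetherianRing R] {M : Type u} [AddCommGroup M]
    [Module R M] [Module.Finite R M] (h : IsStableGZero R M) (h3 : 𝔪 ^ 3 = ⊥)
    (hG : ¬ IsGorensteinLocalRing R) {n : ℕ} {π : (Fin n → R) →ₗ[R] M}
    (hπ : Function.Surjective π) (hk : LinearMap.ker π ≤ 𝔪 • ⊤) (hn : 0 < n) :
    numGen R (LinearMap.ker π) = numGen R (Module.Dual R M) := by
  have hK := h.ker hπ hk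
  have hnM : numGen R M = n := by rw [← numGen_eq_of_surjective π hπ hk, numGen_pi]
  have h1 : Subsingleton (ExtM R M R 1) := h.gdim.ext_eq_zero 1 one_pos
  have hs := isSES_ker hπ
  have hd := hs.dual
  have e1 := ell_eq_add_of_exact _ _ hs.inj hs.surj hs.exact
  have e2 := ell_eq_add_of_exact _ _ hd.inj hd.surj hd.exact
  rw [ell_congr ((Pi.basisFun R (Fin n)).constr R).symm, e1] at e2
  have r1 := h.ratio hK h3 hG
  have r2 := h.ratio hK.dual h3 hG
  have r3 := h.ratio h.dual h3 hG
  have a1 := numGen_add_ell_smul_top (R := R) M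
  have a2 := numGen_add_ell_smul_top (R := R) (LinearMap.ker π)
  have a3 := numGen_add_ell_smul_top (R := R) (Module.Dual R M)
  have a4 := numGen_add_ell_smul_top (R := R) (Module.Dual R (LinearMap.ker π))
  rw [numGen_dual_ker h hπ] at a4 r2
  rw [hnM] at *
  exact eq_of_proportional hn r1 r2 r3 (by omega)

/-- The syzygies of `M` and of `M*` are generated by `b(M*)` and `b(M)` elements, where `b`
is the number of generators.  With this, the lengths of the minimal covers of `M` and `M*` force
`b(M) = b(M*)`. -/
theorem IsStableGZero.numGen_dual [IsNoetherianRing R] {M : Type u} [AddCommGroup M]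
    [Module R M] [Module.Finite R M] (h : IsStableGZero R M) (h3 : 𝔪 ^ 3 = ⊥)
    (hG : ¬ IsGorensteinLocalRing R) : numGen R (Module.Dual R M) = numGen R M := by
  rcases Nat.eq_zero_or_pos (numGen R M) with h0 | hb
  · have := numGen_eq_zero_iff.mp h0
    rw [h0, numGen_eq_zero_iff]
    infer_instance
  have hb' : 0 < numGen R (Module.Dual R M) := by
    rw [Nat.pos_iff_ne_zero, ne_eq, numGen_eq_zero_iff]
    intro _
    exact hb.ne' (numGen_eq_zero_iff.mpr h.gdim.bijective_eval.1.subsingleton)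
  obtain ⟨π, hπ, hk⟩ := exists_surjective_ker_le (R := R) M
  obtain ⟨ρ, hρ, hl⟩ := exists_surjective_ker_le (R := R) (Module.Dual R M)
  have k1 := h.numGen_ker_eq_numGen_dual h3 hG hπ hk hb
  have k2 := h.dual.numGen_ker_eq_numGen_dual h3 hG hρ hl hb'
  rw [← numGen_congr (LinearEquiv.ofBijective _ h.gdim.bijective_eval)] at k2
  have hs := isSES_ker hπ
  have ht := isSES_ker hρ
  have e1 := ell_eq_add_of_exact _ _ hs.inj hs.surj hs.exact
  have e2 := ell_eq_add_of_exact _ _ ht.inj ht.surj ht.exact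
  have r1 := h.ratio (h.ker hπ hk) h3 hG
  have r2 := h.dual.ratio (h.dual.ker hρ hl) h3 hG
  have r3 := h.ratio h.dual h3 hG
  have a1 := numGen_add_ell_smul_top (R := R) M
  have a2 := numGen_add_ell_smul_top (R := R) (LinearMap.ker π)
  have a3 := numGen_add_ell_smul_top (R := R) (Module.Dual R M)
  have a4 := numGen_add_ell_smul_top (R := R) (LinearMap.ker ρ)
  rw [ell_pi] at e1 e2
  rw [← a1, ← a2] at e1
  rw [← a3, ← a4] at e2
  rw [k1] at e1 r1
  rw [k2] at e2 r2
  generalize numGen R M = b at *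
  generalize numGen R (Module.Dual R M) = d at *
  generalize ell R (𝔪 • ⊤ : Submodule R M) = c at *
  generalize ell R (𝔪 • ⊤ : Submodule R (Module.Dual R M)) = cD at *
  generalize ell R (𝔪 • ⊤ : Submodule R (LinearMap.ker π)) = c' at *
  generalize ell R (𝔪 • ⊤ : Submodule R (LinearMap.ker ρ)) = c'' at *
  generalize ell R R = L at *
  clear * - e1 e2 r1 r2 r3 hb hb'
  -- both `L b²` and `L b d` are equal to `(b + d) (b + c)`
  have f1 : b * L * b = (b + d) * (b + c) := by
    linear_combination b * e1 - r1
  have f2 : d * (b * L * d) = d * ((b + d) * (b + c)) := by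
    linear_combination b * d * e2 - b * r2 - (d + b) * r3
  have f3 : b * L * d = b * L * b := (Nat.eq_of_mul_eq_mul_left hb' f2).trans f1.symm
  refine Nat.eq_of_mul_eq_mul_left (show 0 < b * L from ?_) f3
  rw [Nat.pos_iff_ne_zero]
  intro h0
  rw [h0, zero_mul] at f1
  have : 0 < (b + d) * (b + c) := by positivity
  omega

theorem IsStableGZero.numGen_ker [IsNoetherianRing R] {M : Type u} [AddCommGroup M]
    [Module R M] [Module.Finite R M] (h : IsStableGZero R M) (h3 : 𝔪 ^ 3 = ⊥)
    (hG : ¬ IsGorensteinLocalRing R) {n : ℕ} {π : (Fin n → R) →ₗ[R] M}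
    (hπ : Function.Surjective π) (hk : LinearMap.ker π ≤ 𝔪 • ⊤) :
    numGen R (LinearMap.ker π) = n := by
  rcases Nat.eq_zero_or_pos n with rfl | hn
  · rw [numGen_eq_zero_iff]
    infer_instance
  · rw [h.numGen_ker_eq_numGen_dual h3 hG hπ hk hn, h.numGen_dual h3 hG,
      ← numGen_eq_of_surjective π hπ hk, numGen_pi]

end Numerics

/-! ### Socles, and the length of the ring -/

section Socle

variable {R : Type u} [CommRing R] [IsLocalRing R]

local notation "𝔪" => maximalIdeal R
local notation "κ" => ResidueField R

variable (R) in
/-- The socle of a module over a local ring: the elements killed by the maximal ideal. -/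
def socle (X : Type*) [AddCommGroup X] [Module R X] : Submodule R X where
  carrier := {x | ∀ a ∈ maximalIdeal R, a • x = 0}
  add_mem' hx hy a ha := by rw [smul_add, hx a ha, hy a ha, add_zero]
  zero_mem' a _ := smul_zero a
  smul_mem' c x hx a ha := by rw [smul_comm, hx a ha, smul_zero]

theorem mem_socle {X : Type*} [AddCommGroup X] [Module R X] {x : X} :
    x ∈ socle R X ↔ ∀ a ∈ 𝔪, a • x = 0 := Iff.rfl

/-- An isomorphism of modules restricts to the socles. -/
def socleCongr {X Y : Type*} [AddCommGroup X] [Module R X] [AddCommGroup Y] [Module R Y]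
    (e : X ≃ₗ[R] Y) : socle R X ≃ₗ[R] socle R Y :=
  e.ofSubmodules _ _ (by
    ext y
    simp only [Submodule.mem_map_equiv, mem_socle, ← map_smul, LinearEquiv.map_eq_zero_iff])

theorem mem_socle_pi {n : ℕ} {x : Fin n → R} : x ∈ socle R (Fin n → R) ↔ ∀ i, x i ∈ socle R R := by
  simp only [mem_socle, funext_iff, Pi.smul_apply, Pi.zero_apply]
  exact ⟨fun h i a ha => h a ha i, fun h a ha i => h i a ha⟩

variable (R) in
/-- The socle of a dual module `X*` is `Hom(X / 𝔪 X, R)`. -/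
def socleDualEquiv (X : Type*) [AddCommGroup X] [Module R X] :
    ((X ⧸ (𝔪 • ⊤ : Submodule R X)) →ₗ[R] R) ≃ₗ[R] socle R (Module.Dual R X) where
  toFun φ := ⟨φ ∘ₗ Submodule.mkQ _, fun a ha => LinearMap.ext fun x => by
    change a • φ (Submodule.mkQ _ x) = 0
    rw [← map_smul, smul_top_quotient_eq_zero ha, map_zero]⟩
  map_add' _ _ := rfl
  map_smul' _ _ := rfl
  invFun φ := Submodule.liftQ _ φ.1 (by
    rw [Submodule.smul_le]
    intro a ha x _
    rw [LinearMap.mem_ker, map_smul]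
    exact LinearMap.congr_fun (φ.2 a ha) x)
  left_inv φ := by ext; rfl
  right_inv φ := by ext; rfl

theorem socle_pi_eq (hs : socle R R = 𝔪 ^ 2) (n : ℕ) :
    socle R (Fin n → R) = (𝔪 ^ 2) • ⊤ := by
  ext x
  rw [mem_socle_pi, mem_smul_top_pi_iff, hs]

variable [IsArtinianRing R]

theorem ell_socle_dual (X : Type u) [AddCommGroup X] [Module R X] [Module.Finite R X] :
    ell R (socle R (Module.Dual R X)) = numGen R X * ell R (κ →ₗ[R] R) := by
  rw [← ell_congr (socleDualEquiv R X),
    ell_hom_of_smul_eq_zero R _ fun a ha => smul_top_quotient_eq_zero ha]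
  rfl

theorem ell_socle_pi (n : ℕ) : ell R (socle R (Fin n → R)) = n * ell R (κ →ₗ[R] R) := by
  rw [← ell_congr (socleCongr ((Pi.basisFun R (Fin n)).constr R).symm), ell_socle_dual, numGen_pi]

theorem ell_socle_self : ell R (socle R R) = ell R (κ →ₗ[R] R) := by
  rw [← ell_congr (socleCongr (LinearEquiv.funUnique (Fin 1) R R)), ell_socle_pi, one_mul]

variable [IsNoetherianRing R]

/-- The socle of `M ≃ M**` is `Hom(M* / 𝔪 M*, R)`. -/
theorem IsStableGZero.ell_socle {M : Type u} [AddCommGroup M] [Module R M] [Module.Finite R M]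
    (h : IsStableGZero R M) (h3 : 𝔪 ^ 3 = ⊥) (hG : ¬ IsGorensteinLocalRing R) :
    ell R (socle R M) = numGen R M * ell R (κ →ₗ[R] R) := by
  rw [ell_congr (socleCongr (LinearEquiv.ofBijective _ h.gdim.bijective_eval)), ell_socle_dual,
    h.numGen_dual h3 hG]

/-- The socle of the free cover is contained in the syzygy, because both have the same length as
the socle of the syzygy. -/
theorem IsStableGZero.socle_le_ker {M : Type u} [AddCommGroup M] [Module R M] [Module.Finite R M]
    (h : IsStableGZero R M) (h3 : 𝔪 ^ 3 = ⊥) (hG : ¬ IsGorensteinLocalRing R) {n : ℕ}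
    {π : (Fin n → R) →ₗ[R] M} (hπ : Function.Surjective π) (hk : LinearMap.ker π ≤ 𝔪 • ⊤) :
    socle R (Fin n → R) ≤ LinearMap.ker π := by
  have h1 : (socle R (LinearMap.ker π)).map (LinearMap.ker π).subtype ≤ socle R (Fin n → R) := by
    rintro _ ⟨x, hx, rfl⟩ a ha
    exact congrArg Subtype.val (hx a ha)
  rw [← Submodule.eq_of_le_of_ell_le h1]
  · exact Submodule.map_subtype_le _ _
  · have h2 : ell R (socle R (LinearMap.ker π)) =
        ell R ((socle R (LinearMap.ker π)).map (LinearMap.ker π).subtype) :=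
      ell_congr (Submodule.equivMapOfInjective _ (Submodule.injective_subtype _) _)
    rw [← h2, (h.ker hπ hk).ell_socle h3 hG, ell_socle_pi, h.numGen_ker h3 hG hπ hk]

/-- Otherwise the residue field would be a direct summand, hence of G-dimension zero. -/
theorem IsStableGZero.socle_le_smul_top {M : Type u} [AddCommGroup M] [Module R M]
    [Module.Finite R M] (h : IsStableGZero R M) (hG : ¬ IsGorensteinLocalRing R) :
    socle R M ≤ 𝔪 • ⊤ := by
  intro x hx
  by_contra hx'
  obtain ⟨i, p, hpi⟩ := exists_residueField_retract hx hx'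
  have h1 : Subsingleton (ExtM R M R 1) := h.gdim.ext_eq_zero 1 one_pos
  have := subsingleton_ext_of_retract R i p hpi 1
  exact hG isGorensteinLocalRing_of_subsingleton_ext_one

theorem IsStableGZero.socle_le_smul_ker {M : Type u} [AddCommGroup M] [Module R M]
    [Module.Finite R M] (h : IsStableGZero R M) (h3 : 𝔪 ^ 3 = ⊥)
    (hG : ¬ IsGorensteinLocalRing R) {n : ℕ} {π : (Fin n → R) →ₗ[R] M}
    (hπ : Function.Surjective π) (hk : LinearMap.ker π ≤ 𝔪 • ⊤) :
    socle R (Fin n → R) ≤ 𝔪 • LinearMap.ker π := by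
  intro x hx
  have h1 := (h.ker hπ hk).socle_le_smul_top hG
    (show (⟨x, h.socle_le_ker h3 hG hπ hk hx⟩ : LinearMap.ker π) ∈ socle R _ from
      fun a ha => Subtype.ext (hx a ha))
  have h2 := Submodule.mem_map_of_mem (f := (LinearMap.ker π).subtype) h1
  rwa [Submodule.map_smul'', Submodule.map_subtype_top] at h2

/-- A socle element of `R` gives a socle element of the free cover `F` of `M`, and these lie in
`𝔪 K ⊆ 𝔪² F`. -/
theorem socle_self_eq {M : Type u} [AddCommGroup M] [Module R M] [Module.Finite R M]
    [Nontrivial M] (h : IsStableGZero R M) (h3 : 𝔪 ^ 3 = ⊥)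
    (hG : ¬ IsGorensteinLocalRing R) : socle R R = 𝔪 ^ 2 := by
  apply le_antisymm
  · intro x hx
    obtain ⟨π, hπ, hk⟩ := exists_surjective_ker_le (R := R) M
    have hb : 0 < numGen R M := numGen_pos M
    have h1 := h.socle_le_smul_ker h3 hG hπ hk
      (show (fun _ => x) ∈ socle R (Fin (numGen R M) → R) from mem_socle_pi.mpr fun _ => hx)
    have h2 : 𝔪 • LinearMap.ker π ≤ (𝔪 ^ 2) • ⊤ := by
      rw [pow_two, ← smul_eq_mul, Submodule.smul_assoc]
      exact smul_mono_right _ hk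
    exact mem_smul_top_pi_iff.mp (h2 h1) ⟨0, hb⟩
  · intro x hx a ha
    rw [← Ideal.mem_bot, ← h3, pow_succ', smul_eq_mul]
    exact Ideal.mul_mem_mul ha hx

theorem IsStableGZero.smul_ker_eq {M : Type u} [AddCommGroup M] [Module R M]
    [Module.Finite R M] (h : IsStableGZero R M) (h3 : 𝔪 ^ 3 = ⊥)
    (hG : ¬ IsGorensteinLocalRing R) (hs : socle R R = 𝔪 ^ 2) {n : ℕ}
    {π : (Fin n → R) →ₗ[R] M} (hπ : Function.Surjective π) (hk : LinearMap.ker π ≤ 𝔪 • ⊤) :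
    𝔪 • LinearMap.ker π = (𝔪 ^ 2) • ⊤ := by
  apply le_antisymm
  · rw [pow_two, ← smul_eq_mul, Submodule.smul_assoc]
    exact smul_mono_right _ hk
  · rw [← socle_pi_eq hs]
    exact h.socle_le_smul_ker h3 hG hπ hk

/-- For the syzygy `K`, this is the equality `𝔪 K = 𝔪² F`; it passes from `K` to `M` because the
ratio of the two sides is the same for both. -/
theorem IsStableGZero.ell_smul_top {M : Type u} [AddCommGroup M] [Module R M]
    [Module.Finite R M] (h : IsStableGZero R M) (h3 : 𝔪 ^ 3 = ⊥)
    (hG : ¬ IsGorensteinLocalRing R) (hs : socle R R = 𝔪 ^ 2) :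
    ell R (𝔪 • ⊤ : Submodule R M) = numGen R M * ell R (κ →ₗ[R] R) := by
  rcases Nat.eq_zero_or_pos (numGen R M) with h0 | hb
  · have := numGen_eq_zero_iff.mp h0
    rw [h0, zero_mul, ell_of_subsingleton]
  obtain ⟨π, hπ, hk⟩ := exists_surjective_ker_le (R := R) M
  have h1 : ell R (𝔪 • ⊤ : Submodule R (LinearMap.ker π)) = numGen R M * ell R (κ →ₗ[R] R) := by
    rw [ell_smul_top_coe, h.smul_ker_eq h3 hG hs hπ hk,
      ← socle_pi_eq hs, ell_socle_pi]
  have h2 := h.ratio (h.ker hπ hk) h3 hG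
  rw [h1, h.numGen_ker h3 hG hπ hk, mul_comm] at h2
  exact Nat.eq_of_mul_eq_mul_left hb h2

theorem IsStableGZero.ell_eq {M : Type u} [AddCommGroup M] [Module R M]
    [Module.Finite R M] (h : IsStableGZero R M) (h3 : 𝔪 ^ 3 = ⊥)
    (hG : ¬ IsGorensteinLocalRing R) (hs : socle R R = 𝔪 ^ 2) :
    ell R M = numGen R M * (1 + ell R (κ →ₗ[R] R)) := by
  rw [← numGen_add_ell_smul_top, h.ell_smul_top h3 hG hs, mul_add, mul_one]

theorem ell_self_eq {M : Type u} [AddCommGroup M] [Module R M] [Module.Finite R M]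
    [Nontrivial M] (h : IsStableGZero R M) (h3 : 𝔪 ^ 3 = ⊥)
    (hG : ¬ IsGorensteinLocalRing R) (hs : socle R R = 𝔪 ^ 2) :
    ell R R = 2 * (1 + ell R (κ →ₗ[R] R)) := by
  have hb : 0 < numGen R M := numGen_pos M
  obtain ⟨π, hπ, hk⟩ := exists_surjective_ker_le (R := R) M
  have hse := isSES_ker hπ
  have e1 := ell_eq_add_of_exact _ _ hse.inj hse.surj hse.exact
  rw [ell_pi, (h.ker hπ hk).ell_eq h3 hG hs, h.ell_eq h3 hG hs, h.numGen_ker h3 hG hπ hk] at e1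
  refine Nat.eq_of_mul_eq_mul_left hb (e1.trans ?_)
  ring

theorem ext_succ_succ_eq {M : Type u} [AddCommGroup M] [Module R M] [Module.Finite R M]
    [Nontrivial M] (h : IsStableGZero R M) (h3 : 𝔪 ^ 3 = ⊥)
    (hG : ¬ IsGorensteinLocalRing R) (hs : socle R R = 𝔪 ^ 2) (i : ℕ) :
    ell R (ExtM R κ R (i + 1 + 1)) = ell R (κ →ₗ[R] R) * ell R (ExtM R κ R (i + 1)) := by
  have hb : 0 < numGen R M := numGen_pos M
  have h1 := h.ext_ratio h3 i
  rw [h.ell_smul_top h3 hG hs, mul_assoc] at h1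
  exact (Nat.eq_of_mul_eq_mul_left hb h1).symm

theorem ext_one_add_one_eq {M : Type u} [AddCommGroup M] [Module R M] [Module.Finite R M]
    [Nontrivial M] (h : IsStableGZero R M) (h3 : 𝔪 ^ 3 = ⊥)
    (hG : ¬ IsGorensteinLocalRing R) (hs : socle R R = 𝔪 ^ 2) :
    ell R (ExtM R κ R 1) + 1 = ell R (κ →ₗ[R] R) * ell R (κ →ₗ[R] R) := by
  have hb : 0 < numGen R M := numGen_pos M
  have h1 := h.ell_dual h3
  rw [h.ell_smul_top h3 hG hs, h.dual.ell_eq h3 hG hs, h.numGen_dual h3 hG] at h1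
  refine Nat.eq_of_mul_eq_mul_left hb ?_
  linarith

end Socle

/-! ### Ext of the residue field with itself -/

section Koszul

variable {R : Type u} [CommRing R] [IsLocalRing R]

local notation "𝔪" => maximalIdeal R
local notation "κ" => ResidueField R

/-- Modules killed by `𝔪` are vector spaces, so that their embeddings split. -/
theorem exists_retract_of_smul_eq_zero {V W : Type*} [AddCommGroup V] [Module R V]
    [AddCommGroup W] [Module R W] (hV : ∀ a ∈ 𝔪, ∀ v : V, a • v = 0)
    (hW : ∀ a ∈ 𝔪, ∀ w : W, a • w = 0) (j : V →ₗ[R] W) (hj : Function.Injective j) :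
    ∃ ρ : W →ₗ[R] V, ρ ∘ₗ j = LinearMap.id := by
  have hV' : Module.IsTorsionBySet R V (𝔪 : Set R) := fun x a => hV a a.2 x
  have hW' : Module.IsTorsionBySet R W (𝔪 : Set R) := fun x a => hW a a.2 x
  let : Module κ V := hV'.module
  let : Module κ W := hW'.module
  have : IsScalarTower R κ V := hV'.isScalarTower
  have : IsScalarTower R κ W := hW'.isScalarTower
  let j' : V →ₗ[κ] W := j.extendScalarsOfSurjective residue_surjective
  obtain ⟨ρ, hρ⟩ := j'.exists_leftInverse_of_injective (LinearMap.ker_eq_bot.mpr hj)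
  exact ⟨ρ.restrictScalars R, LinearMap.ext fun x => LinearMap.congr_fun hρ x⟩

/-- Homomorphisms to `κ` vanish on `𝔪 F`, which contains the syzygy of a minimal cover. -/
theorem extMap_subtype_ker_eq_zero {X : Type u} [AddCommGroup X] [Module R X] {n : ℕ}
    {π : (Fin n → R) →ₗ[R] X} (hk : LinearMap.ker π ≤ 𝔪 • ⊤) (i : ℕ) :
    extMap κ (LinearMap.ker π).subtype i = 0 := by
  obtain _ | i := i
  · ext x
    apply (extZeroEquiv R _ κ).injective
    rw [extZeroEquiv_extMap, LinearMap.zero_apply, map_zero]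
    refine LinearMap.ext fun y => ?_
    have : (𝔪 • ⊤ : Submodule R (Fin n → R)) ≤ LinearMap.ker (extZeroEquiv R _ κ x) := by
      rw [Submodule.smul_le]
      intro a ha y _
      rw [LinearMap.mem_ker, map_smul, smul_residueField_eq_zero ha]
    exact this (hk y.2)
  · have := subsingleton_ext_of_projective (R := R) (A := Fin n → R) κ i
    exact extMap_eq_zero_of_subsingleton κ _ _

theorem ell_ext_succ_of_cover {X : Type u} [AddCommGroup X] [Module R X] {n : ℕ}
    {π : (Fin n → R) →ₗ[R] X} (hπ : Function.Surjective π) (hk : LinearMap.ker π ≤ 𝔪 • ⊤)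
    (i : ℕ) : ell R (ExtM R X κ (i + 1)) = ell R (ExtM R (LinearMap.ker π) κ i) := by
  have := subsingleton_ext_of_projective (R := R) (A := Fin n → R) κ i
  exact (ell_congr (LinearEquiv.ofBijective _
    ((isSES_ker hπ).δ_bijective κ i (extMap_subtype_ker_eq_zero hk i)))).symm

/-- If `𝔪 K = 𝔪² F` for the syzygy `K ⊆ 𝔪 F`, then `K → K / 𝔪 K` extends to `𝔪 F`. -/
theorem exists_extend_mkQ_ker {X : Type u} [AddCommGroup X] [Module R X] {n : ℕ}
    {π : (Fin n → R) →ₗ[R] X} (hk : LinearMap.ker π ≤ 𝔪 • ⊤)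
    (hm : 𝔪 • LinearMap.ker π = (𝔪 ^ 2) • ⊤) :
    ∃ ρ : (𝔪 • ⊤ : Submodule R (Fin n → R)) →ₗ[R]
        (LinearMap.ker π ⧸ (𝔪 • ⊤ : Submodule R (LinearMap.ker π))),
      ρ ∘ₗ Submodule.inclusion hk = Submodule.mkQ _ := by
  let j := Submodule.mapQ _ _ (Submodule.inclusion hk)
    (Submodule.smul_top_le_comap_smul_top 𝔪 (Submodule.inclusion hk))
  have hj : Function.Injective j := by
    rw [← LinearMap.ker_eq_bot, LinearMap.ker_eq_bot']
    intro x hx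
    obtain ⟨x, rfl⟩ := Submodule.mkQ_surjective _ x
    have h1 : Submodule.inclusion hk x ∈ (𝔪 • ⊤ : Submodule R (𝔪 • ⊤ : Submodule R (Fin n → R))) :=
      (Submodule.Quotient.mk_eq_zero _).mp hx
    have h2 := Submodule.mem_map_of_mem (f := Submodule.subtype _) h1
    rw [Submodule.map_smul'', Submodule.map_subtype_top, ← Submodule.smul_assoc, smul_eq_mul,
      ← pow_two, ← hm] at h2
    have h4 : 𝔪 • LinearMap.ker π =
        (𝔪 • ⊤ : Submodule R (LinearMap.ker π)).map (LinearMap.ker π).subtype := by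
      rw [Submodule.map_smul'', Submodule.map_subtype_top]
    rw [h4] at h2
    obtain ⟨y, hy, hyx⟩ := h2
    have : y = x := Subtype.ext hyx
    exact (Submodule.Quotient.mk_eq_zero _).mpr (this ▸ hy)
  obtain ⟨ρ, hρ⟩ := exists_retract_of_smul_eq_zero (fun a ha => smul_top_quotient_eq_zero ha)
    (fun a ha => smul_top_quotient_eq_zero ha) j hj
  refine ⟨ρ ∘ₗ Submodule.mkQ _, LinearMap.ext fun x => ?_⟩
  exact LinearMap.congr_fun hρ (Submodule.mkQ _ x)

variable [IsArtinianRing R]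

theorem ell_ext_residueField_zero : ell R (ExtM R κ κ 0) = 1 := by
  rw [ell_congr (extZeroEquiv R κ κ), ell_hom_residueField]
  have h1 := numGen_add_ell_smul_top (R := R) κ
  have h2 : (𝔪 • ⊤ : Submodule R κ) = ⊥ := by
    rw [eq_bot_iff, Submodule.smul_le]
    intro a ha x _
    rw [smul_residueField_eq_zero ha]
    exact Submodule.zero_mem _
  rwa [h2, ell_of_subsingleton, ell_residueField] at h1

variable [IsNoetherianRing R]

theorem IsStableGZero.ell_ext_residueField {M : Type u} [AddCommGroup M] [Module R M]
    [Module.Finite R M] (h : IsStableGZero R M) (h3 : 𝔪 ^ 3 = ⊥)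
    (hG : ¬ IsGorensteinLocalRing R) (i : ℕ) : ell R (ExtM R M κ i) = numGen R M := by
  induction i generalizing M with
  | zero => rw [ell_congr (extZeroEquiv R M κ), ell_hom_residueField]
  | succ i ih =>
    obtain ⟨π, hπ, hk⟩ := exists_surjective_ker_le (R := R) M
    rw [ell_ext_succ_of_cover hπ hk, ih (h.ker hπ hk), h.numGen_ker h3 hG hπ hk]

/-- The Koszul property of stable modules: `Ext(M / 𝔪 M, κ) → Ext(M, κ)` is surjective.  Restricting a
class `δ y` of `Ext^{i+1}(M, κ)`, with `y` in `Ext^i(K, κ)`, to `𝔪 M` gives the image of `y` under the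
connecting map of `0 → K → 𝔪 F → 𝔪 M → 0`; it vanishes because `y` comes from `K / 𝔪 K` by induction
and so extends to `𝔪 F`. -/
theorem IsStableGZero.extMap_mkQ_surjective {M : Type u} [AddCommGroup M] [Module R M]
    [Module.Finite R M] (h : IsStableGZero R M) (h3 : 𝔪 ^ 3 = ⊥)
    (hG : ¬ IsGorensteinLocalRing R) (hs : socle R R = 𝔪 ^ 2) (i : ℕ) :
    Function.Surjective (extMap κ (Submodule.mkQ (𝔪 • ⊤ : Submodule R M)) i) := by
  induction i generalizing M with
  | zero =>
    refine extMap_zero_surjective κ fun φ => ⟨Submodule.liftQ _ φ ?_, Submodule.liftQ_mkQ _ _ _⟩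
    rw [Submodule.smul_le]
    intro a ha x _
    rw [LinearMap.mem_ker, map_smul, smul_residueField_eq_zero ha]
  | succ i ih =>
    intro x
    obtain ⟨π, hπ, hk⟩ := exists_surjective_ker_le (R := R) M
    have hM := isSES_ker hπ
    have := subsingleton_ext_of_projective (R := R) (A := Fin (numGen R M) → R) κ i
    obtain ⟨y, rfl⟩ := (hM.exact_right κ i x).mp (Subsingleton.elim _ _)
    refine ((isSES_subtype_mkQ _).exact_mid κ (i + 1) _).mp ?_
    have hmap : (𝔪 • ⊤ : Submodule R (Fin (numGen R M) → R)).map π = 𝔪 • ⊤ := by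
      rw [Submodule.map_smul'', Submodule.map_top, LinearMap.range_eq_top.mpr hπ]
    let g : (𝔪 • ⊤ : Submodule R (Fin (numGen R M) → R)) →ₗ[R] (𝔪 • ⊤ : Submodule R M) :=
      π.restrict fun z hz => hmap ▸ Submodule.mem_map_of_mem hz
    have hmM : IsSES (Submodule.inclusion hk) g := by
      refine ⟨Submodule.inclusion_injective hk, fun z => ?_, ?_⟩
      · constructor
        · intro hz
          exact ⟨⟨z.1, congrArg Subtype.val hz⟩, rfl⟩
        · rintro ⟨z, rfl⟩
          exact Subtype.ext z.2
      · rintro ⟨z, hz⟩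
        rw [← hmap] at hz
        obtain ⟨w, hw, rfl⟩ := hz
        exact ⟨⟨w, hw⟩, rfl⟩
    rw [hmM.extMap_δ κ hM LinearMap.id (Submodule.subtype _) (Submodule.subtype _) rfl rfl,
      extMap_id]
    obtain ⟨η, rfl⟩ := ih (h.ker hπ hk) y
    obtain ⟨ρ, hρ⟩ := exists_extend_mkQ_ker hk (h.smul_ker_eq h3 hG hs hπ hk)
    rw [← hρ, extMap_comp]
    exact (hmM.exact_left κ i).apply_apply_eq_zero _

/-- By surjectivity of `Ext(M / 𝔪 M, κ) → Ext(M, κ)`, the long exact sequence breaks up into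
`0 → Ext^i(𝔪 M, κ) → Ext^{i+1}(M / 𝔪 M, κ) → Ext^{i+1}(M, κ) → 0`. -/
theorem ell_ext_residueField_succ {M : Type u} [AddCommGroup M] [Module R M] [Module.Finite R M]
    [Nontrivial M] (h : IsStableGZero R M) (h3 : 𝔪 ^ 3 = ⊥)
    (hG : ¬ IsGorensteinLocalRing R) (hs : socle R R = 𝔪 ^ 2) (i : ℕ) :
    ell R (ExtM R κ κ (i + 1)) = ell R (κ →ₗ[R] R) * ell R (ExtM R κ κ i) + 1 := by
  have hb : 0 < numGen R M := numGen_pos M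
  have hse := isSES_subtype_mkQ (𝔪 • ⊤ : Submodule R M)
  have h0 : extMap κ (𝔪 • ⊤ : Submodule R M).subtype i = 0 := by
    ext x
    obtain ⟨y, rfl⟩ := h.extMap_mkQ_surjective h3 hG hs i x
    exact (hse.exact_mid κ i).apply_apply_eq_zero y
  have hinj : Function.Injective (hse.δ κ i) := by
    rw [injective_iff_map_eq_zero]
    intro x hx
    obtain ⟨y, rfl⟩ := (hse.exact_left κ i x).mp hx
    rw [h0, LinearMap.zero_apply]
  have e1 := ell_eq_add_of_exact _ _ hinj (h.extMap_mkQ_surjective h3 hG hs (i + 1))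
    (hse.exact_right κ i)
  rw [ell_ext_of_smul_eq_zero κ (M ⧸ (𝔪 • ⊤ : Submodule R M))
      fun a ha => smul_top_quotient_eq_zero ha,
    ell_ext_of_smul_eq_zero κ (𝔪 • ⊤ : Submodule R M) (h.smul_smul_top_eq_zero h3),
    h.ell_smul_top h3 hG hs, h.ell_ext_residueField h3 hG] at e1
  change numGen R M * _ = _ at e1
  refine Nat.eq_of_mul_eq_mul_left hb (e1.trans ?_)
  ring

end Koszul

/-! ### Length and dimension over a coefficient field -/

section FinrankLength

variable {k : Type*} [Field k] {R : Type*} [CommRing R] [IsLocalRing R] [Algebra k R]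

local notation "𝔪" => maximalIdeal R
local notation "κ" => ResidueField R

/-- The simple `R`-module `κ` is one-dimensional over `k`. -/
theorem length_eq_length_of_coefficientField
    (hk : Function.Bijective (algebraMap k (ResidueField R))) {X : Type*} [AddCommGroup X]
    [Module R X] (hX : IsFiniteLength R X) : ∀ [Module k X] [IsScalarTower k R X],
    Module.length k X = Module.length R X := by
  induction hX with
  | of_subsingleton => intros; rw [Module.length_eq_zero, Module.length_eq_zero]
  | @of_simple_quotient M _ _ N hN _ ih =>
    intro _ _
    obtain ⟨I, hI, ⟨e⟩⟩ := isSimpleModule_iff_quot_maximal.mp hN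
    rw [eq_maximalIdeal hI] at e
    let e' : (M ⧸ N) ≃ₗ[R] κ := e
    have h1 : Module.length k (M ⧸ N) = 1 := by
      rw [(e'.restrictScalars k).length_eq,
        ← (LinearEquiv.ofBijective (Algebra.linearMap k κ) hk).length_eq, Module.length_eq_one]
    rw [Module.length_eq_add_of_exact N.subtype N.mkQ N.injective_subtype N.mkQ_surjective
        (LinearMap.exact_subtype_mkQ N),
      Module.length_eq_add_of_exact (N.subtype.restrictScalars k) (N.mkQ.restrictScalars k)
        N.injective_subtype N.mkQ_surjective (LinearMap.exact_subtype_mkQ N), ih, h1,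
      Module.length_eq_one_iff.mpr hN]

variable [IsArtinianRing R]

theorem length_eq_ell (hk : Function.Bijective (algebraMap k (ResidueField R))) (X : Type*)
    [AddCommGroup X] [Module R X] [Module.Finite R X] [Module k X] [IsScalarTower k R X] :
    Module.length k X = ell R X := by
  rw [length_eq_length_of_coefficientField (R := R) hk
    (isFiniteLength_iff_isNoetherian_isArtinian.mpr ⟨inferInstance, inferInstance⟩), coe_ell]

theorem finite_of_coefficientField (hk : Function.Bijective (algebraMap k (ResidueField R)))
    (X : Type*) [AddCommGroup X] [Module R X] [Module.Finite R X] [Module k X]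
    [IsScalarTower k R X] : Module.Finite k X := by
  have h1 : Module.length k X ≠ ⊤ := by
    rw [length_eq_ell (R := R) hk]
    exact ENat.natCast_ne_top _
  have := (isFiniteLength_iff_isNoetherian_isArtinian.mp (Module.length_ne_top_iff.mp h1)).1
  infer_instance

theorem finrank_eq_ell (hk : Function.Bijective (algebraMap k (ResidueField R))) (X : Type*)
    [AddCommGroup X] [Module R X] [Module.Finite R X] [Module k X] [IsScalarTower k R X] :
    Module.finrank k X = ell R X := by
  have := finite_of_coefficientField (R := R) hk X
  have h1 := length_eq_ell (R := R) hk X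
  rw [Module.length_eq_finrank] at h1
  exact_mod_cast h1

theorem finrank_restrictScalars_eq_ell (hk : Function.Bijective (algebraMap k (ResidueField R)))
    {X : Type*} [AddCommGroup X] [Module R X] [Module.Finite R X] [Module k X]
    [IsScalarTower k R X] (N : Submodule R X) :
    Module.finrank k (N.restrictScalars k) = ell R N :=
  finrank_eq_ell (R := R) hk N

theorem kdim_eq_ell (hk : Function.Bijective (algebraMap k (ResidueField R))) (X : Type*)
    [AddCommGroup X] [Module R X] [Module.Finite R X] : kdim k R X = ell R X := by
  let : Module k X := Module.compHom X (algebraMap k R)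
  have : IsScalarTower k R X := IsScalarTower.of_algebraMap_smul fun _ _ => rfl
  exact finrank_eq_ell (R := R) hk X

/-- A `k`-complement of `𝔪 X` in `X` has a basis which is a minimal generating set of `X`. -/
theorem exists_cover_of_isCompl (hk : Function.Bijective (algebraMap k (ResidueField R)))
    {X : Type*} [AddCommGroup X] [Module R X] [Module.Finite R X] [Module k X]
    [IsScalarTower k R X] (X₀ : Submodule k X)
    (hX : IsCompl X₀ ((𝔪 • ⊤ : Submodule R X).restrictScalars k)) :
    Module.finrank k X₀ = numGen R X ∧ ∃ f : (Fin (numGen R X) → R) →ₗ[R] X,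
      Function.Surjective f ∧ LinearMap.ker f ≤ 𝔪 • ⊤ ∧ ∀ i, f (Pi.single i 1) ∈ X₀ := by
  have := finite_of_coefficientField (R := R) hk X
  have h1 : Module.finrank k X₀ = numGen R X := by
    have h2 := Submodule.finrank_add_eq_of_isCompl hX
    rw [finrank_eq_ell (R := R) hk X, ← numGen_add_ell_smul_top,
      finrank_restrictScalars_eq_ell hk] at h2
    omega
  refine ⟨h1, ?_⟩
  let b := Module.finBasisOfFinrankEq k X₀ h1
  let f := Fintype.linearCombination R (fun i => (b i : X))
  have hf (i) : f (Pi.single i 1) = b i := by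
    simp [f, Fintype.linearCombination_apply_single]
  have hfs : Function.Surjective f := by
    rw [← LinearMap.range_eq_top]
    apply span_eq_top_of_sup_smul_top
    rw [eq_top_iff]
    intro x _
    obtain ⟨y, hy, z, hz, rfl⟩ := Submodule.mem_sup.mp
      (hX.sup_eq_top ▸ Submodule.mem_top : x ∈ X₀ ⊔ (𝔪 • ⊤ : Submodule R X).restrictScalars k)
    refine Submodule.add_mem_sup ?_ hz
    have h3 := b.sum_repr ⟨y, hy⟩
    have h4 := congrArg Subtype.val h3
    simp only [Submodule.coe_sum, Submodule.coe_smul] at h4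
    rw [← h4]
    refine Submodule.sum_mem _ fun i _ => ?_
    rw [← algebraMap_smul R]
    exact Submodule.smul_mem _ _ ⟨_, hf i⟩
  exact ⟨f, hfs, ker_le_smul_top_of_surjective f hfs le_rfl, fun i => by rw [hf]; exact (b i).2⟩

end FinrankLength

/-! ### Gradings with three pieces -/

section ThreePieces

variable {k : Type*} [Field k] {X : Type*} [AddCommGroup X] [Module k X]

/-- The family of subspaces with pieces `A`, `B`, `C` in degrees `0`, `1`, `2` and nothing else. -/
def threePieces (A B C : Submodule k X) : ℕ → Submodule k X
  | 0 => A
  | 1 => B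
  | 2 => C
  | _ => ⊥

/-- The space `X` is the direct sum of the subspaces `A`, `B` and `C`. -/
structure IsDirectSumOfThree (A B C : Submodule k X) : Prop where
  eq_zero : ∀ a ∈ A, ∀ b ∈ B, ∀ c ∈ C, a + b + c = 0 → a = 0 ∧ b = 0 ∧ c = 0
  exists_add : ∀ x, ∃ a ∈ A, ∃ b ∈ B, ∃ c ∈ C, a + b + c = x

theorem IsDirectSumOfThree.isInternal {A B C : Submodule k X} (h : IsDirectSumOfThree A B C) :
    DirectSum.IsInternal (threePieces A B C) := by
  classical
  have h3 (i) (x : threePieces A B C (i + 3)) : x = 0 := Subtype.ext x.2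
  constructor
  · rw [injective_iff_map_eq_zero]
    intro x hx
    have hsub : x.support ⊆ Finset.range 3 := by
      intro i hi
      rw [DFinsupp.mem_support_iff] at hi
      by_contra hi'
      obtain ⟨j, rfl⟩ := Nat.exists_eq_add_of_le' (not_lt.mp (Finset.mem_range.not.mp hi'))
      exact hi (h3 j _)
    rw [DirectSum.coeAddMonoidHom_eq_dfinsuppSum, DFinsupp.sum,
      Finset.sum_subset hsub fun i _ hi => by rw [DFinsupp.notMem_support_iff.mp hi]; rfl,
      Finset.sum_range_succ, Finset.sum_range_succ, Finset.sum_range_one] at hx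
    obtain ⟨e0, e1, e2⟩ := h.eq_zero _ (x 0).2 _ (x 1).2 _ (x 2).2 hx
    refine DFinsupp.ext fun i => ?_
    match i with
    | 0 => exact Subtype.ext e0
    | 1 => exact Subtype.ext e1
    | 2 => exact Subtype.ext e2
    | j + 3 => exact h3 j _
  · intro x
    obtain ⟨a, ha, b, hb, c, hc, rfl⟩ := h.exists_add x
    refine ⟨DirectSum.of (fun i => threePieces A B C i) 0 ⟨a, ha⟩ +
      DirectSum.of (fun i => threePieces A B C i) 1 ⟨b, hb⟩ +
      DirectSum.of (fun i => threePieces A B C i) 2 ⟨c, hc⟩, ?_⟩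
    simp only [map_add, DirectSum.coeAddMonoidHom_of]

end ThreePieces

/-! ### The grading of the ring -/

section RingGrading

variable {k : Type*} [Field k] {R : Type*} [CommRing R] [IsLocalRing R] [Algebra k R]

local notation "𝔪" => maximalIdeal R
local notation "κ" => ResidueField R

/-- `V` is a `k`-linear complement of `𝔪²` in `𝔪`. -/
structure IsCotangentComplement (V : Submodule k R) : Prop where
  sup_eq : V ⊔ (maximalIdeal R ^ 2).restrictScalars k = (maximalIdeal R).restrictScalars k
  disjoint : Disjoint V ((maximalIdeal R ^ 2).restrictScalars k)

variable (k R) in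
theorem exists_isCotangentComplement : ∃ V : Submodule k R, IsCotangentComplement V := by
  obtain ⟨W, hW⟩ := Submodule.exists_isCompl ((𝔪 ^ 2).restrictScalars k)
  have hle : (𝔪 ^ 2).restrictScalars k ≤ (𝔪 : Ideal R).restrictScalars k :=
    Ideal.pow_le_self two_ne_zero
  refine ⟨W ⊓ (𝔪 : Ideal R).restrictScalars k, ?_, hW.disjoint.symm.mono_left inf_le_left⟩
  rw [sup_comm, ← sup_inf_assoc_of_le _ hle, hW.sup_eq_top, top_inf_eq]

/-- The grading `R = k ⊕ V ⊕ 𝔪²`. -/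
def shortGrading (V : Submodule k R) : ℕ → Submodule k R :=
  threePieces (LinearMap.range (Algebra.linearMap k R)) V ((maximalIdeal R ^ 2).restrictScalars k)

variable {V : Submodule k R}

theorem IsCotangentComplement.le (hV : IsCotangentComplement V) {x : R} (hx : x ∈ V) : x ∈ 𝔪 := by
  have : x ∈ V ⊔ (𝔪 ^ 2).restrictScalars k := Submodule.mem_sup_left hx
  rwa [hV.sup_eq] at this

theorem IsCotangentComplement.exists_add (hV : IsCotangentComplement V) {x : R} (hx : x ∈ 𝔪) :
    ∃ v ∈ V, ∃ w ∈ 𝔪 ^ 2, v + w = x := by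
  have : x ∈ V ⊔ (𝔪 ^ 2).restrictScalars k := by rwa [hV.sup_eq]
  exact Submodule.mem_sup.mp this

theorem IsCotangentComplement.eq_zero (hV : IsCotangentComplement V) {x : R} (hx : x ∈ V)
    (hx' : x ∈ 𝔪 ^ 2) : x = 0 :=
  Submodule.disjoint_def.mp hV.disjoint x hx hx'

theorem mul_eq_zero_of_pow_three (h3 : 𝔪 ^ 3 = ⊥) {x y : R} (hx : x ∈ 𝔪) (hy : y ∈ 𝔪 ^ 2) :
    x * y = 0 := by
  rw [← Ideal.mem_bot, ← h3, pow_succ']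
  exact Ideal.mul_mem_mul hx hy

theorem algebraMap_mem_maximalIdeal_iff (hk : Function.Bijective (algebraMap k (ResidueField R)))
    {c : k} : algebraMap k R c ∈ 𝔪 ↔ c = 0 := by
  rw [← residue_eq_zero_iff, ← ResidueField.algebraMap_eq, ← IsScalarTower.algebraMap_apply,
    map_eq_zero_iff _ hk.1]

theorem isDirectSumOfThree_shortGrading
    (hk : Function.Bijective (algebraMap k (ResidueField R))) (hV : IsCotangentComplement V) :
    IsDirectSumOfThree (LinearMap.range (Algebra.linearMap k R)) V
      ((maximalIdeal R ^ 2).restrictScalars k) := by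
  constructor
  · rintro _ ⟨a, rfl⟩ b hb c hc h
    rw [Algebra.linearMap_apply] at *
    have hbc : b + c ∈ 𝔪 := add_mem (hV.le hb) (Ideal.pow_le_self two_ne_zero hc)
    have ha : algebraMap k R a ∈ 𝔪 := by
      rw [add_assoc] at h
      rw [eq_neg_of_add_eq_zero_left h]
      exact neg_mem hbc
    rw [(algebraMap_mem_maximalIdeal_iff hk).mp ha, map_zero] at h ⊢
    rw [zero_add] at h
    have hb' : b = 0 := hV.eq_zero hb (by
      rw [eq_neg_of_add_eq_zero_left h]; exact neg_mem hc)
    exact ⟨rfl, hb', by rwa [hb', zero_add] at h⟩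
  · intro x
    obtain ⟨a, ha⟩ := hk.2 (residue R x)
    have hx : x - algebraMap k R a ∈ 𝔪 := by
      rw [← residue_eq_zero_iff, map_sub, sub_eq_zero, ← ha]
      rfl
    obtain ⟨v, hv, w, hw, h⟩ := hV.exists_add hx
    exact ⟨_, ⟨a, rfl⟩, v, hv, w, hw, by rw [add_assoc, h, Algebra.linearMap_apply]; ring⟩

theorem gradedMonoid_shortGrading (h3 : 𝔪 ^ 3 = ⊥) (hV : IsCotangentComplement V) :
    SetLike.GradedMonoid (shortGrading V) where
  one_mem := ⟨1, by simp⟩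
  mul_mem := by
    intro i j x y hx hy
    match i, j with
    | 0, j =>
      obtain ⟨c, rfl⟩ := hx
      rw [Algebra.linearMap_apply, ← Algebra.smul_def, zero_add]
      exact Submodule.smul_mem _ c hy
    | i + 1, 0 =>
      obtain ⟨c, rfl⟩ := hy
      rw [Algebra.linearMap_apply, mul_comm, ← Algebra.smul_def, add_zero]
      exact Submodule.smul_mem _ c hx
    | 1, 1 =>
      change x * y ∈ 𝔪 ^ 2
      rw [pow_two]
      exact Ideal.mul_mem_mul (hV.le hx) (hV.le hy)
    | 1, 2 =>
      rw [mul_eq_zero_of_pow_three h3 (hV.le hx) hy]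
      exact Submodule.zero_mem _
    | 2, 1 =>
      rw [mul_comm, mul_eq_zero_of_pow_three h3 (hV.le hy) hx]
      exact Submodule.zero_mem _
    | 2, 2 =>
      rw [mul_eq_zero_of_pow_three h3 (Ideal.pow_le_self two_ne_zero hx) hy]
      exact Submodule.zero_mem _
    | i + 3, j =>
      rw [(show x = 0 from hx), zero_mul]
      exact Submodule.zero_mem _
    | i, j + 3 =>
      rw [(show y = 0 from hy), mul_zero]
      exact Submodule.zero_mem _

/-- `R = k ⊕ V ⊕ 𝔪²` as a graded algebra. -/
@[reducible]
noncomputable def shortGradedAlgebra (hk : Function.Bijective (algebraMap k (ResidueField R)))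
    (h3 : 𝔪 ^ 3 = ⊥) (hV : IsCotangentComplement V) : GradedAlgebra (shortGrading V) where
  __ := gradedMonoid_shortGrading h3 hV
  __ := (isDirectSumOfThree_shortGrading hk hV).isInternal.chooseDecomposition

/-- `𝔪² = V²`, so that `V` generates `R`. -/
theorem isHomogeneousGraded_shortGrading
    (hk : Function.Bijective (algebraMap k (ResidueField R)))
    (h3 : 𝔪 ^ 3 = ⊥) (hV : IsCotangentComplement V) : IsHomogeneousGraded (shortGrading V) := by
  refine ⟨rfl, ?_⟩
  have h2 : ∀ x ∈ 𝔪 ^ 2, x ∈ Algebra.adjoin k (V : Set R) := by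
    intro x hx
    rw [pow_two] at hx
    induction hx using Submodule.mul_induction_on' with
    | mem_mul_mem x hx y hy =>
      obtain ⟨v, hv, w, hw, rfl⟩ := hV.exists_add hx
      obtain ⟨v', hv', w', hw', rfl⟩ := hV.exists_add hy
      have e1 := mul_eq_zero_of_pow_three h3 (hV.le hv) hw'
      have e2 := mul_eq_zero_of_pow_three h3 hy hw
      have : (v + w) * (v' + w') = v * v' := by linear_combination e1 + e2
      rw [this]
      exact mul_mem (Algebra.subset_adjoin hv) (Algebra.subset_adjoin hv')
    | add x _ y _ hx hy => exact add_mem hx hy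
  rw [eq_top_iff]
  intro x _
  obtain ⟨a, ha⟩ := hk.2 (residue R x)
  have hx : x - algebraMap k R a ∈ 𝔪 := by
    rw [← residue_eq_zero_iff, map_sub, sub_eq_zero, ← ha]
    rfl
  obtain ⟨v, hv, w, hw, h⟩ := hV.exists_add hx
  rw [← sub_add_cancel x (algebraMap k R a), ← h]
  exact add_mem (add_mem (Algebra.subset_adjoin hv) (h2 w hw)) (Subalgebra.algebraMap_mem _ a)

theorem irrelevant_shortGrading
    (hV : IsCotangentComplement V) [GradedAlgebra (shortGrading V)] :
    (HomogeneousIdeal.irrelevant (shortGrading V)).toIdeal = 𝔪 := by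
  have hmem (i : ℕ) (x : R) (hx : x ∈ shortGrading V (i + 1)) :
      x ∈ (HomogeneousIdeal.irrelevant (shortGrading V)).toIdeal := by
    change x ∈ HomogeneousIdeal.irrelevant (shortGrading V)
    rw [HomogeneousIdeal.mem_irrelevant_iff, GradedRing.proj_apply,
      DirectSum.decompose_of_mem_ne _ hx (by omega)]
  refine ((maximalIdeal.isMaximal R).eq_of_le ?_ ?_).symm
  · rw [Ideal.ne_top_iff_one]
    intro h
    change (1 : R) ∈ HomogeneousIdeal.irrelevant (shortGrading V) at h
    rw [HomogeneousIdeal.mem_irrelevant_iff, GradedRing.proj_apply,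
      DirectSum.decompose_of_mem_same _ (SetLike.GradedOne.one_mem)] at h
    exact one_ne_zero h
  · intro x hx
    obtain ⟨v, hv, w, hw, rfl⟩ := hV.exists_add hx
    exact add_mem (hmem 0 v hv) (hmem 1 w hw)

end RingGrading

/-! ### Graded free modules -/

section TwistedFree

theorem apply_mem_of_single_mem {k R : Type*} [Field k] [CommRing R] {b : ℕ} {M : Type*}
    [AddCommGroup M] [Module R M] [Module k M] {N : Submodule k M} (f : (Fin b → R) →ₗ[R] M)
    {x : Fin b → R} (h : ∀ i, x i • f (Pi.single i 1) ∈ N) : f x ∈ N := by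
  rw [pi_eq_sum_univ' x, map_sum]
  refine Submodule.sum_mem _ fun i _ => ?_
  rw [map_smul]
  convert h i using 3

variable {k : Type*} [Field k] {R : Type*} [CommRing R] [Algebra k R]

theorem mem_twistedFree {𝒜 : ℕ → Submodule k R} {n b j : ℕ} {x : Fin b → R} :
    x ∈ twistedFree 𝒜 n b (n + j) ↔ ∀ i, x i ∈ 𝒜 j := by
  simp [twistedFree, Submodule.mem_pi]

theorem eq_zero_of_mem_twistedFree {𝒜 : ℕ → Submodule k R} {n b j : ℕ} (hj : j < n)
    {x : Fin b → R} (hx : x ∈ twistedFree 𝒜 n b j) : x = 0 := by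
  funext i
  have := hx i trivial
  simpa [not_le.mpr hj] using this

end TwistedFree

/-! ### Construction of linear resolutions -/

section LinearCovers

variable {k : Type*} [Field k] {R : Type*} [CommRing R] [IsLocalRing R] [Algebra k R]
  {V : Submodule k R}

local notation "𝔪" => maximalIdeal R
local notation "κ" => ResidueField R

variable [IsArtinianRing R]

/-- One step of a linear resolution: a submodule `K` of `𝔪 F` with `𝔪² F ⊆ 𝔪 K` is minimally
generated by elements with coordinates in `V`. -/
theorem exists_linear_cover (hk : Function.Bijective (algebraMap k (ResidueField R)))
    (hV : IsCotangentComplement V) {a : ℕ} {K : Submodule R (Fin a → R)}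
    (hK : K ≤ 𝔪 • ⊤) (hK' : (𝔪 ^ 2) • ⊤ ≤ 𝔪 • K)
    {b : ℕ} (hb : numGen R K = b) :
    ∃ f : (Fin b → R) →ₗ[R] K, Function.Surjective f ∧ LinearMap.ker f ≤ 𝔪 • ⊤ ∧
      ∀ i l, (f (Pi.single i 1) : Fin a → R) l ∈ V := by
  subst hb
  let K₁ : Submodule k K :=
    (Submodule.pi Set.univ fun _ => V : Submodule k (Fin a → R)).comap (K.subtype.restrictScalars k)
  have hK₁ (x : K) : x ∈ K₁ ↔ ∀ l, (x : Fin a → R) l ∈ V := by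
    simp [K₁, Submodule.mem_pi]
  have hmap : (𝔪 • ⊤ : Submodule R K).map K.subtype = 𝔪 • K := by
    rw [Submodule.map_smul'', Submodule.map_subtype_top]
  have hle : 𝔪 • K ≤ (𝔪 ^ 2) • ⊤ := by
    rw [pow_two, ← smul_eq_mul, Submodule.smul_assoc]
    exact smul_mono_right _ hK
  have hc : IsCompl K₁ ((𝔪 • ⊤ : Submodule R K).restrictScalars k) := by
    constructor
    · rw [Submodule.disjoint_def]
      intro x hx hx'
      have h0 : K.subtype x ∈ 𝔪 • K := hmap ▸ Submodule.mem_map_of_mem (f := K.subtype)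
        (show x ∈ (𝔪 • ⊤ : Submodule R K) from hx')
      have h1 := mem_smul_top_pi_iff.mp (hle h0)
      exact Subtype.ext (funext fun l => hV.eq_zero ((hK₁ x).mp hx l) (h1 l))
    · rw [codisjoint_iff, eq_top_iff]
      rintro ⟨x, hx⟩ _
      choose v hv w hw hvw using fun l => hV.exists_add (mem_smul_top_pi_iff.mp (hK hx) l)
      have hwK : w ∈ 𝔪 • K := hK' (mem_smul_top_pi_iff.mpr hw)
      have hwK' := hwK
      rw [← hmap] at hwK'
      obtain ⟨w', hw', hww⟩ := hwK'
      have hvK : v ∈ K := by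
        have : v = x - w := funext fun l => by rw [Pi.sub_apply, ← hvw l]; ring
        rw [this]
        exact sub_mem hx (Submodule.smul_le_right hwK)
      have : (⟨x, hx⟩ : K) = ⟨v, hvK⟩ + w' :=
        Subtype.ext (funext fun l => by
          change x l = v l + (K.subtype w') l
          rw [hww, hvw l])
      rw [this]
      exact Submodule.add_mem_sup ((hK₁ _).mpr hv) hw'
  obtain ⟨-, f, hf, hf', hf''⟩ := exists_cover_of_isCompl (R := R) hk K₁ hc
  exact ⟨f, hf, hf', fun i => (hK₁ _).mp (hf'' i)⟩

/-- Splicing linear covers: a property `P` of submodules `K` of `𝔪 F` with `𝔪² F ⊆ 𝔪 K` which is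
inherited by syzygies produces a linear resolution. -/
theorem exists_linear_resolution (hk : Function.Bijective (algebraMap k (ResidueField R)))
    (h3 : 𝔪 ^ 3 = ⊥) (hV : IsCotangentComplement V) (β : ℕ → ℕ)
    (P : ∀ n, Submodule R (Fin (β n) → R) → Prop)
    (h1 : ∀ n K, P n K → K ≤ 𝔪 • ⊤ ∧ (𝔪 ^ 2) • ⊤ ≤ 𝔪 • K ∧ numGen R K = β (n + 1))
    (h2 : ∀ n K, P n K → ∀ π : (Fin (β (n + 1)) → R) →ₗ[R] K, Function.Surjective π →
      LinearMap.ker π ≤ 𝔪 • ⊤ → P (n + 1) (LinearMap.ker π))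
    (K₀ : Submodule R (Fin (β 0) → R)) (hK₀ : P 0 K₀) :
    ∃ d : ∀ n, (Fin (β (n + 1)) → R) →ₗ[R] (Fin (β n) → R),
      LinearMap.range (d 0) = K₀ ∧ (∀ n, Function.Exact (d (n + 1)) (d n)) ∧
      ∀ n j, ∀ x ∈ twistedFree (shortGrading V) (n + 1) (β (n + 1)) j,
        d n x ∈ twistedFree (shortGrading V) n (β n) j := by
  have step (n : ℕ) (K : {K // P n K}) : ∃ d : (Fin (β (n + 1)) → R) →ₗ[R] (Fin (β n) → R),
      LinearMap.range d = K.1 ∧ P (n + 1) (LinearMap.ker d) ∧ ∀ i l, d (Pi.single i 1) l ∈ V := by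
    obtain ⟨K, hK⟩ := K
    obtain ⟨hK1, hK2, hK3⟩ := h1 n K hK
    obtain ⟨f, hf, hf', hf''⟩ := exists_linear_cover hk hV hK1 hK2 hK3
    have h4 := h2 n K hK f hf hf'
    refine ⟨K.subtype ∘ₗ f, ?_, ?_, hf''⟩
    · rw [LinearMap.range_comp, LinearMap.range_eq_top.mpr hf, Submodule.map_subtype_top]
    · rwa [LinearMap.ker_comp_of_ker_eq_bot _ K.ker_subtype]
  choose d hd hd' hd'' using step
  let s : ∀ n, {K // P n K} := Nat.rec ⟨K₀, hK₀⟩ fun n K => ⟨LinearMap.ker (d n K), hd' n K⟩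
  refine ⟨fun n => d n (s n), hd 0 _, fun n => ?_, fun n j x hx => ?_⟩
  · rw [LinearMap.exact_iff, hd]
  · rcases Nat.lt_or_ge j (n + 1) with hj | hj
    · rw [eq_zero_of_mem_twistedFree hj hx, map_zero]
      exact Submodule.zero_mem _
    · obtain ⟨j, rfl⟩ := Nat.exists_eq_add_of_le hj
      rw [mem_twistedFree] at hx
      refine apply_mem_of_single_mem _ fun i => ?_
      rw [add_assoc, mem_twistedFree]
      intro l
      have h4 : d n (s n) (Pi.single i 1) l ∈ shortGrading V 1 := hd'' n (s n) i l
      have h5 := (gradedMonoid_shortGrading h3 hV).mul_mem h4 (hx i)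
      rwa [mul_comm] at h5

end LinearCovers

/-! ### Tor from a minimal resolution -/

section TorResidueField

variable {R : Type u} [CommRing R]

/-- A sequence `⋯ → R^{β 1} → R^{β 0}` of composable maps with zero composites, as a complex. -/
noncomputable def freeComplex (β : ℕ → ℕ) (d : ∀ n, (Fin (β (n + 1)) → R) →ₗ[R] (Fin (β n) → R))
    (h : ∀ n, d n ∘ₗ d (n + 1) = 0) : ChainComplex (ModuleCat.{u} R) ℕ :=
  ChainComplex.of (fun n => ModuleCat.of R (Fin (β n) → R)) (fun n => ModuleCat.ofHom (d n))
    fun n => ModuleCat.hom_ext (h n)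

theorem freeComplex_d (β : ℕ → ℕ) (d : ∀ n, (Fin (β (n + 1)) → R) →ₗ[R] (Fin (β n) → R))
    (h : ∀ n, d n ∘ₗ d (n + 1) = 0) (n : ℕ) :
    (freeComplex β d h).d (n + 1) n = ModuleCat.ofHom (d n) :=
  ChainComplex.of_d (fun n => ModuleCat.of R (Fin (β n) → R)) (fun n => ModuleCat.ofHom (d n)) n

/-- An exact sequence `⋯ → R^{β 1} → R^{β 0} → X → 0` as a projective resolution of `X`. -/
noncomputable def freeResolution {X : Type u} [AddCommGroup X] [Module R X] (β : ℕ → ℕ)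
    (d : ∀ n, (Fin (β (n + 1)) → R) →ₗ[R] (Fin (β n) → R)) (ε : (Fin (β 0) → R) →ₗ[R] X)
    (hε : Function.Surjective ε) (h0 : Function.Exact (d 0) ε)
    (h : ∀ n, Function.Exact (d (n + 1)) (d n)) : ProjectiveResolution (ModuleCat.of R X) where
  complex := freeComplex β d fun n => (h n).linearMap_comp_eq_zero
  projective n := (IsProjective.iff_projective (Fin (β n) → R)).mp inferInstance
  π := (ChainComplex.toSingle₀Equiv _ _).symm ⟨ModuleCat.ofHom ε, by
    rw [freeComplex_d]
    exact ModuleCat.hom_ext h0.linearMap_comp_eq_zero⟩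
  quasiIso := ⟨fun n => by
    cases n
    · rw [ChainComplex.quasiIsoAt₀_iff, ShortComplex.quasiIso_iff_of_zeros']
      · refine (ShortComplex.exact_and_epi_g_iff_of_iso
          (S₂ := ModuleCat.shortComplexOfCompEqZero (d 0) ε h0.linearMap_comp_eq_zero) ?_).2
          ⟨ModuleCat.shortComplex_exact _ h0, (ModuleCat.epi_iff_surjective _).mpr hε⟩
        refine ShortComplex.isoMk (Iso.refl _) (Iso.refl _) (Iso.refl _) ?_ ?_
        · exact (Category.id_comp _).trans
            ((freeComplex_d β d (fun n => (h n).linearMap_comp_eq_zero) 0).symm.trans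
              (Category.comp_id _).symm)
        · refine (Category.id_comp _).trans (Eq.trans ?_ (Category.comp_id _).symm)
          rfl
      all_goals rfl
    · rename_i n
      rw [quasiIsoAt_iff_exactAt']
      · rw [HomologicalComplex.exactAt_iff' _ (n + 1 + 1) (n + 1) n (by simp) (by simp)]
        apply ModuleCat.shortComplex_exact
        simp only [HomologicalComplex.sc', HomologicalComplex.shortComplexFunctor',
          freeComplex_d]
        exact h n
      · apply ChainComplex.exactAt_succ_single_obj⟩

variable [IsLocalRing R]

local notation "𝔪" => maximalIdeal R
local notation "κ" => ResidueField R

open MonoidalCategory in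
/-- A minimal free resolution of `X` computes `Tor(κ, X)`: tensoring with `κ` kills its maps. -/
theorem nonempty_tor_residueField_equiv {X : Type u} [AddCommGroup X] [Module R X]
    (β : ℕ → ℕ)
    (d : ∀ n, (Fin (β (n + 1)) → R) →ₗ[R] (Fin (β n) → R)) (ε : (Fin (β 0) → R) →ₗ[R] X)
    (hε : Function.Surjective ε) (h0 : Function.Exact (d 0) ε)
    (h : ∀ n, Function.Exact (d (n + 1)) (d n))
    (hd : ∀ n x i, d n x i ∈ 𝔪) (n : ℕ) :
    Nonempty ((((Tor (ModuleCat.{u} R) n).obj (ModuleCat.of R κ)).obj (ModuleCat.of R X)) ≃ₗ[R]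
      (Fin (β n) → κ)) := by
  let P := freeResolution β d ε hε h0 h
  let F := (tensoringLeft (ModuleCat.{u} R)).obj (ModuleCat.of R κ)
  have hF (i j) : F.map (P.complex.d i j) = 0 := by
    by_cases hij : j + 1 = i
    · subst hij
      have : P.complex.d (j + 1) j = ModuleCat.ofHom (d j)   :=
        freeComplex_d β d (fun n => (h n).linearMap_comp_eq_zero) j
      rw [this]
      refine ModuleCat.hom_ext (TensorProduct.ext' fun x y => ?_)
      change x ⊗ₜ[R] (d j y) = 0
      have h1 : x ⊗ₜ[R] (d j y) ∈ (⊥ : Submodule R (TensorProduct R κ (Fin (β j) → R))) := by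
        rw [pi_eq_sum_univ' (d j y), TensorProduct.tmul_sum]
        refine Submodule.sum_mem _ fun i _ => ?_
        rw [← TensorProduct.smul_tmul, smul_residueField_eq_zero (hd j y i),
          TensorProduct.zero_tmul]
        exact Submodule.zero_mem _
      exact h1
    · rw [P.complex.shape i j hij, F.map_zero]
  let K := (F.mapHomologicalComplex (ComplexShape.down ℕ)).obj P.complex
  let e : K.homology n ≅ K.X n :=
    (ShortComplex.HomologyData.ofZeros (K.sc n) (hF _ _) (hF _ _)).left.homologyIso
  let e' : ((Tor (ModuleCat.{u} R) n).obj (ModuleCat.of R κ)).obj (ModuleCat.of R X) ≅ K.X n :=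
    (P.isoLeftDerivedObj F n).trans e
  let e'' : (TensorProduct R κ (Fin (β n) → R)) ≃ₗ[R] (Fin (β n) → κ) :=
    TensorProduct.piScalarRight R R κ (Fin (β n))
  exact ⟨e'.toLinearEquiv.trans e''⟩

end TorResidueField

/-! ### The resolution of the residue field -/

section ResidueCover

variable {R : Type u} [CommRing R] [IsLocalRing R]

local notation "𝔪" => maximalIdeal R
local notation "κ" => ResidueField R

theorem ker_residue_proj :
    LinearMap.ker (Algebra.linearMap R κ ∘ₗ (LinearMap.proj 0 : (Fin 1 → R) →ₗ[R] R)) =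
      (𝔪 • ⊤ : Submodule R (Fin 1 → R)) := by
  ext x
  rw [mem_smul_top_pi_iff, LinearMap.mem_ker, Fin.forall_fin_one]
  exact residue_eq_zero_iff _

theorem surjective_residue_proj : Function.Surjective
    (Algebra.linearMap R κ ∘ₗ (LinearMap.proj 0 : (Fin 1 → R) →ₗ[R] R)) := by
  intro x
  obtain ⟨a, rfl⟩ := residue_surjective x
  exact ⟨fun _ => a, rfl⟩

theorem ell_smul_smul_top_pi [IsArtinianRing R] (hs : socle R R = 𝔪 ^ 2) (n : ℕ) :
    ell R ((𝔪 ^ 2) • ⊤ : Submodule R (Fin n → R)) = n * ell R (κ →ₗ[R] R) := by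
  rw [← socle_pi_eq hs, ell_socle_pi]

end ResidueCover

section Resolutions

/-- The coefficients of `1 / ((1 - t) (1 - r t))`. -/
def betti (r : ℕ) : ℕ → ℕ
  | 0 => 1
  | n + 1 => r * betti r n + 1

variable {k : Type*} [Field k] {R : Type u} [CommRing R] [IsLocalRing R] [Algebra k R]
  {V : Submodule k R}

local notation "𝔪" => maximalIdeal R
local notation "κ" => ResidueField R

/-- A linear resolution is minimal. -/
theorem apply_mem_maximalIdeal_of_degree (hV : IsCotangentComplement V) {n a b : ℕ}
    (d : (Fin b → R) →ₗ[R] (Fin a → R))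
    (hd : ∀ j, ∀ x ∈ twistedFree (shortGrading V) (n + 1) b j,
      d x ∈ twistedFree (shortGrading V) n a j) (x : Fin b → R) (i : Fin a) : d x i ∈ 𝔪 := by
  have h1 : d x ∈ ((𝔪 • ⊤ : Submodule R (Fin a → R)).restrictScalars k) := by
    refine apply_mem_of_single_mem _ fun l =>
      Submodule.smul_mem (𝔪 • ⊤ : Submodule R (Fin a → R)) _ ?_
    refine mem_smul_top_pi_iff.mpr fun j => hV.le ?_
    have h2 : (Pi.single l 1 : Fin b → R) ∈ twistedFree (shortGrading V) (n + 1) b (n + 1 + 0) := by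
      refine mem_twistedFree.mpr fun j => ?_
      by_cases hj : j = l
      · subst hj
        exact ⟨1, by simp⟩
      · rw [Pi.single_eq_of_ne hj]
        exact Submodule.zero_mem _
    exact mem_twistedFree.mp (hd _ _ h2) j
  exact mem_smul_top_pi_iff.mp h1 i

theorem isKoszulGraded_shortGrading (hk : Function.Bijective (algebraMap k (ResidueField R)))
    (h3 : 𝔪 ^ 3 = ⊥) (hV : IsCotangentComplement V) [GradedAlgebra (shortGrading V)] {r : ℕ}
    (d : ∀ n, (Fin (betti r (n + 1)) → R) →ₗ[R] (Fin (betti r n) → R))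
    (h0 : LinearMap.range (d 0) = 𝔪 • ⊤) (h : ∀ n, Function.Exact (d (n + 1)) (d n))
    (hd : ∀ n j, ∀ x ∈ twistedFree (shortGrading V) (n + 1) (betti r (n + 1)) j,
        d n x ∈ twistedFree (shortGrading V) n (betti r n) j) :
    IsKoszulGraded (shortGrading V) := by
  let e : κ ≃ₗ[R] R ⧸ (HomogeneousIdeal.irrelevant (shortGrading V)).toIdeal :=
    Submodule.quotEquivOfEq _ _ (irrelevant_shortGrading hV).symm
  let ε : (Fin (betti r 0) → R) →ₗ[R] κ :=
    Algebra.linearMap R κ ∘ₗ (LinearMap.proj 0 : (Fin 1 → R) →ₗ[R] R)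
  have hε : LinearMap.ker ε = 𝔪 • ⊤ := ker_residue_proj
  refine ⟨isHomogeneousGraded_shortGrading hk h3 hV, betti r, d, e.toLinearMap ∘ₗ ε,
    e.surjective.comp surjective_residue_proj, ?_, h, fun j x hx => ?_, hd⟩
  · rw [LinearMap.exact_iff, h0, LinearMap.ker_comp, LinearEquiv.ker]
    exact hε
  · obtain _ | j := j
    · exact Submodule.mem_top
    · rw [← zero_add (j + 1), mem_twistedFree] at hx
      have h2 : x ∈ LinearMap.ker ε := by
        rw [hε, mem_smul_top_pi_iff]
        intro i
        match j, hx i with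
        | 0, h => exact hV.le h
        | 1, h => exact Ideal.pow_le_self two_ne_zero h
        | j + 2, h => exact (show x i = 0 from h) ▸ zero_mem _
      change e (ε x) = 0
      rw [LinearMap.mem_ker.mp h2, map_zero]

variable [IsArtinianRing R] [IsNoetherianRing R]

theorem ell_ext_residueField_eq_betti {M : Type u} [AddCommGroup M] [Module R M]
    [Module.Finite R M] [Nontrivial M] (h : IsStableGZero R M) (h3 : 𝔪 ^ 3 = ⊥)
    (hG : ¬ IsGorensteinLocalRing R) (hs : socle R R = 𝔪 ^ 2) (n : ℕ) :
    ell R (ExtM R κ κ n) = betti (ell R (κ →ₗ[R] R)) n := by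
  induction n with
  | zero => exact ell_ext_residueField_zero
  | succ n ih => rw [ell_ext_residueField_succ h h3 hG hs, ih, betti]

/-- The syzygies `K ⊆ 𝔪 F` of the residue field satisfy `𝔪 K = 𝔪² F`, by counting lengths: the length of
`R` and the Betti numbers are known.  Hence the minimal resolution is linear. -/
theorem exists_linear_resolution_residueField
    (hk : Function.Bijective (algebraMap k (ResidueField R)))
    (h3 : 𝔪 ^ 3 = ⊥) (hV : IsCotangentComplement V) (hs : socle R R = 𝔪 ^ 2) {r : ℕ}
    (hr : ell R (κ →ₗ[R] R) = r) (hL : ell R R = 2 * (1 + r))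
    (hext : ∀ n, ell R (ExtM R κ κ n) = betti r n) :
    ∃ d : ∀ n, (Fin (betti r (n + 1)) → R) →ₗ[R] (Fin (betti r n) → R),
      LinearMap.range (d 0) = 𝔪 • ⊤ ∧ (∀ n, Function.Exact (d (n + 1)) (d n)) ∧
      ∀ n j, ∀ x ∈ twistedFree (shortGrading V) (n + 1) (betti r (n + 1)) j,
        d n x ∈ twistedFree (shortGrading V) n (betti r n) j := by
  have hb (n) : betti r (n + 1) = r * betti r n + 1 := rfl
  refine exists_linear_resolution hk h3 hV (betti r)
    (fun n K => K ≤ 𝔪 • ⊤ ∧ (∀ i, ell R (ExtM R K κ i) = betti r (n + 1 + i)) ∧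
      ell R K = betti r (n + 1) + r * betti r n) ?_ ?_ _ ⟨le_rfl, fun i => ?_, ?_⟩
  · rintro n K ⟨hK, hKe, hKl⟩
    have h1 : numGen R K = betti r (n + 1) := by
      rw [← ell_hom_residueField, ← ell_congr (extZeroEquiv R K κ), hKe 0, add_zero]
    have hle : 𝔪 • K ≤ (𝔪 ^ 2) • ⊤ := by
      rw [pow_two, ← smul_eq_mul, Submodule.smul_assoc]
      exact smul_mono_right _ hK
    refine ⟨hK, (Submodule.eq_of_le_of_ell_le hle ?_).ge, h1⟩
    have h4 := numGen_add_ell_smul_top (R := R) K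
    rw [h1, hKl, ell_smul_top_coe] at h4
    rw [ell_smul_smul_top_pi hs, hr, mul_comm]
    omega
  · rintro n K ⟨hK, hKe, hKl⟩ π hπ hk'
    refine ⟨hk', fun i => ?_, ?_⟩
    · rw [← ell_ext_succ_of_cover hπ hk', hKe, add_assoc (n + 1), add_comm 1 i]
    · have hse := isSES_ker hπ
      have e1 := ell_eq_add_of_exact _ _ hse.inj hse.surj hse.exact
      rw [ell_pi, hL, hKl] at e1
      have e2 := hb n
      have e3 := hb (n + 1)
      rw [e3]
      nlinarith
  · have h1 := ell_ext_succ_of_cover (surjective_residue_proj (R := R))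
      (ker_residue_proj (R := R)).le i
    rw [ker_residue_proj, hext] at h1
    rw [add_comm (0 + 1) i, zero_add]
    exact h1.symm
  · have h1 := numGen_add_ell_smul_top (R := R) (Fin 1 → R)
    rw [numGen_pi, ell_pi, hL] at h1
    change ell R (𝔪 • ⊤ : Submodule R (Fin 1 → R)) = r * 1 + 1 + r * 1
    omega

end Resolutions

/-! ### Gradings and resolutions of modules of G-dimension zero -/

section ModuleGrading

variable {k : Type*} [Field k] {R : Type u} [CommRing R] [IsLocalRing R] [Algebra k R]
  {V : Submodule k R}

local notation "𝔪" => maximalIdeal R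

/-- The two-piece grading of a stable module of G-dimension zero, which is killed by `𝔪²`. -/
theorem IsStableGZero.isModuleGrading {M : Type u} [AddCommGroup M] [Module R M] [Module k M]
    [IsScalarTower k R M] (h : IsStableGZero R M) (h3 : 𝔪 ^ 3 = ⊥)
    (hV : IsCotangentComplement V) {M₀ : Submodule k M}
    (hM : IsCompl M₀ ((𝔪 • ⊤ : Submodule R M).restrictScalars k)) :
    IsDirectSumOfThree M₀ ((𝔪 • ⊤ : Submodule R M).restrictScalars k) ⊥ ∧
    IsModuleGrading (shortGrading V)
      (threePieces M₀ ((𝔪 • ⊤ : Submodule R M).restrictScalars k) ⊥) := by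
  have h1 : IsDirectSumOfThree M₀ ((𝔪 • ⊤ : Submodule R M).restrictScalars k) ⊥ := by
    constructor
    · rintro a ha b hb _ rfl hab
      rw [add_zero] at hab
      have hb' : b = 0 := Submodule.disjoint_def.mp hM.disjoint b (by
        rw [eq_neg_of_add_eq_zero_right hab]; exact neg_mem ha) hb
      exact ⟨by rwa [hb', add_zero] at hab, hb', rfl⟩
    · intro x
      have hx : x ∈ M₀ ⊔ (𝔪 • ⊤ : Submodule R M).restrictScalars k := by
        rw [hM.sup_eq_top]
        trivial
      obtain ⟨a, ha, b, hb, rfl⟩ := Submodule.mem_sup.mp hx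
      exact ⟨a, ha, b, hb, 0, Submodule.zero_mem _, add_zero _⟩
  refine ⟨h1, h1.isInternal, fun i j a ha x hx => ?_⟩
  match i, j with
  | 0, j =>
    obtain ⟨c, rfl⟩ := ha
    rw [Algebra.linearMap_apply, algebraMap_smul, zero_add]
    exact Submodule.smul_mem _ c hx
  | 1, 0 => exact (Submodule.smul_mem_smul (hV.le ha) trivial :
      a • x ∈ (𝔪 • ⊤ : Submodule R M))
  | 1, 1 =>
    exact congrArg Subtype.val (h.smul_smul_top_eq_zero h3 a (hV.le ha) ⟨x, hx⟩)
  | i, j + 2 =>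
    have : x = 0 := by
      match j with
      | 0 => exact hx
      | j + 1 => exact hx
    rw [this, smul_zero]
    exact Submodule.zero_mem _
  | 2, j =>
    rw [h.smul_smul_eq_zero h3 ha]
    exact Submodule.zero_mem _
  | i + 3, j =>
    rw [(show a = 0 from ha), zero_smul]
    exact Submodule.zero_mem _

/-- Grading the free part by the grading of `R`. -/
theorem exists_isModuleGrading_of_equiv (hk : Function.Bijective (algebraMap k (ResidueField R)))
    (h3 : 𝔪 ^ 3 = ⊥) (hV : IsCotangentComplement V) {M N : Type*} [AddCommGroup M] [Module R M]
    [Module k M] [IsScalarTower k R M] [AddCommGroup N] [Module R N] [Module k N]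
    [IsScalarTower k R N] {n : ℕ} (e : M ≃ₗ[R] (Fin n → R) × N) {A B C : Submodule k N}
    (hN : IsDirectSumOfThree A B C) (hN' : IsModuleGrading (shortGrading V) (threePieces A B C)) :
    ∃ ℳ : ℕ → Submodule k M, IsModuleGrading (shortGrading V) ℳ := by
  let T (X : Submodule k R) (Y : Submodule k N) : Submodule k M :=
    ((Submodule.pi Set.univ fun _ => X).prod Y).comap (e.restrictScalars k).toLinearMap
  have hT (X Y) (x : M) : x ∈ T X Y ↔ (∀ l, (e x).1 l ∈ X) ∧ (e x).2 ∈ Y := by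
    simp [T, Submodule.mem_pi]
  let ℳ := threePieces (T (LinearMap.range (Algebra.linearMap k R)) A) (T V B)
    (T ((𝔪 ^ 2).restrictScalars k) C)
  have hℳ (i) (x : M) :
      x ∈ ℳ i ↔ (∀ l, (e x).1 l ∈ shortGrading V i) ∧ (e x).2 ∈ threePieces A B C i := by
    match i with
    | 0 => exact hT _ _ x
    | 1 => exact hT _ _ x
    | 2 => exact hT _ _ x
    | i + 3 =>
      change x = 0 ↔ (∀ l, (e x).1 l = 0) ∧ (e x).2 = 0
      rw [← LinearEquiv.map_eq_zero_iff e, Prod.ext_iff, funext_iff]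
      rfl
  refine ⟨ℳ, IsDirectSumOfThree.isInternal ⟨?_, ?_⟩, fun i j a ha x hx => ?_⟩
  · intro a ha b hb c hc habc
    rw [hT] at ha hb hc
    have h1 : e a + e b + e c = 0 := by rw [← map_add, ← map_add, habc, map_zero]
    have h2 (l) := (isDirectSumOfThree_shortGrading hk hV).eq_zero _ (ha.1 l) _ (hb.1 l) _ (hc.1 l)
      (congrFun (congrArg Prod.fst h1) l)
    have h4 := hN.eq_zero _ ha.2 _ hb.2 _ hc.2 (congrArg Prod.snd h1)
    exact ⟨e.map_eq_zero_iff.mp (Prod.ext (funext fun l => (h2 l).1) h4.1),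
      e.map_eq_zero_iff.mp (Prod.ext (funext fun l => (h2 l).2.1) h4.2.1),
      e.map_eq_zero_iff.mp (Prod.ext (funext fun l => (h2 l).2.2) h4.2.2)⟩
  · intro x
    choose a ha b hb c hc habc using
      fun l => (isDirectSumOfThree_shortGrading hk hV).exists_add ((e x).1 l)
    obtain ⟨a', ha', b', hb', c', hc', habc'⟩ := hN.exists_add (e x).2
    refine ⟨e.symm (a, a'), (hT _ _ _).mpr ?_, e.symm (b, b'), (hT _ _ _).mpr ?_,
      e.symm (c, c'), (hT _ _ _).mpr ?_, ?_⟩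
    · rw [e.apply_symm_apply]; exact ⟨ha, ha'⟩
    · rw [e.apply_symm_apply]; exact ⟨hb, hb'⟩
    · rw [e.apply_symm_apply]; exact ⟨hc, hc'⟩
    · rw [← map_add, ← map_add, e.symm_apply_eq]
      exact Prod.ext (funext habc) habc'
  · rw [hℳ] at hx ⊢
    rw [map_smul]
    exact ⟨fun l => (gradedMonoid_shortGrading h3 hV).mul_mem ha (hx.1 l),
      hN'.smul_mem i j a ha _ hx.2⟩

variable [IsArtinianRing R] [IsNoetherianRing R]

/-- A stable module of G-dimension zero and all its syzygies have the same number of generators and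
satisfy `𝔪 K = 𝔪² F`, so that the minimal resolution is linear. -/
theorem IsStableGZero.hasLinearResolution
    (hk : Function.Bijective (algebraMap k (ResidueField R)))
    {M : Type u} [AddCommGroup M] [Module R M] [Module.Finite R M] [Module k M]
    [IsScalarTower k R M] (h : IsStableGZero R M) (h3 : 𝔪 ^ 3 = ⊥)
    (hG : ¬ IsGorensteinLocalRing R) (hs : socle R R = 𝔪 ^ 2)
    (hV : IsCotangentComplement V) {ℳ : ℕ → Submodule k M}
    (hℳ : IsModuleGrading (shortGrading V) ℳ)
    (hM : IsCompl (ℳ 0) ((𝔪 • ⊤ : Submodule R M).restrictScalars k)) :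
    HasLinearResolution (shortGrading V) ℳ (fun _ => numGen R M) := by
  obtain ⟨-, ε, hε, hε', hε''⟩ := exists_cover_of_isCompl (R := R) hk _ hM
  obtain ⟨d, h0, hd, hd'⟩ := exists_linear_resolution hk h3 hV (fun _ => numGen R M)
    (fun _ K => K ≤ 𝔪 • ⊤ ∧ (𝔪 ^ 2) • ⊤ ≤ 𝔪 • K ∧ numGen R K = numGen R M ∧ IsStableGZero R K)
    (fun n K hK => ⟨hK.1, hK.2.1, hK.2.2.1⟩)
    (fun n K hK π hπ hk' => ⟨hk', (hK.2.2.2.smul_ker_eq h3 hG hs hπ hk').ge,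
      hK.2.2.2.numGen_ker h3 hG hπ hk', hK.2.2.2.ker hπ hk'⟩)
    (LinearMap.ker ε) ⟨hε', (h.smul_ker_eq h3 hG hs hε hε').ge, h.numGen_ker h3 hG hε hε',
      h.ker hε hε'⟩
  refine ⟨d, ε, hε, LinearMap.exact_iff.mpr h0.symm, hd, fun j x hx => ?_, hd'⟩
  rw [← zero_add j, mem_twistedFree] at hx
  exact apply_mem_of_single_mem _ fun i => hℳ.smul_mem j 0 _ (hx i) _ (hε'' i)

end ModuleGrading

/-! ### Power series -/

section Series

open PowerSeries in
theorem mk_mul_one_sub_natCast_mul_X {f g : ℕ → ℚ} {r : ℕ} (h0 : f 0 = g 0)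
    (h : ∀ n, f (n + 1) = r * f n + g (n + 1)) :
    PowerSeries.mk f * (1 - (r : PowerSeries ℚ) * PowerSeries.X) = PowerSeries.mk g := by
  ext n
  rw [mul_sub, mul_one, ← mul_assoc, map_sub, coeff_mk, coeff_mk,
    (map_natCast (C (R := ℚ)) r).symm]
  obtain _ | n := n
  · rw [coeff_zero_mul_X, sub_zero, h0]
  · rw [coeff_succ_mul_X, coeff_mul_C, coeff_mk, h]
    ring

theorem coeff_succ_natCast (n r : ℕ) :
    PowerSeries.coeff (n + 1) (r : PowerSeries ℚ) = 0 := by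
  rw [← map_natCast (PowerSeries.C (R := ℚ)), PowerSeries.coeff_C, if_neg n.succ_ne_zero]

theorem mk_betti (r : ℕ) : PowerSeries.mk (fun n => (betti r n : ℚ)) =
    ((1 - PowerSeries.X) * (1 - (r : PowerSeries ℚ) * PowerSeries.X))⁻¹ := by
  rw [PowerSeries.eq_inv_iff_mul_eq_one (by simp), mul_comm (1 - PowerSeries.X), ← mul_assoc,
    mk_mul_one_sub_natCast_mul_X (g := 1) (by simp [betti]) (by simp [betti]),
    PowerSeries.mk_one_mul_one_sub_eq_one]

theorem mk_eq_bass {μ : ℕ → ℕ} {r : ℕ} (h0 : μ 0 = r) (h1 : μ 1 + 1 = r * r)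
    (h : ∀ n, μ (n + 1 + 1) = r * μ (n + 1)) : PowerSeries.mk (fun n => (μ n : ℚ)) =
      ((r : PowerSeries ℚ) - PowerSeries.X) *
        (1 - (r : PowerSeries ℚ) * PowerSeries.X)⁻¹ := by
  rw [PowerSeries.eq_mul_inv_iff_mul_eq (by simp),
    mk_mul_one_sub_natCast_mul_X
      (g := fun n => PowerSeries.coeff n ((r : PowerSeries ℚ) - PowerSeries.X))]
  · ext n
    rw [PowerSeries.coeff_mk]
  · simp [h0]
  · rintro (_ | n)
    · have : (μ 1 : ℚ) + 1 = r * r := by exact_mod_cast h1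
      rw [h0, map_sub, coeff_succ_natCast, zero_add, PowerSeries.coeff_one_X]
      linarith
    · simp [coeff_succ_natCast, h, PowerSeries.coeff_X]

theorem mk_eq_hilbert {h : ℕ → ℕ} {r : ℕ} (h0 : h 0 = 1) (h1 : h 1 = r + 1) (h2 : h 2 = r)
    (h3 : ∀ n, h (n + 3) = 0) : PowerSeries.mk (fun n => (h n : ℚ)) =
      (1 + PowerSeries.X) * (1 + (r : PowerSeries ℚ) * PowerSeries.X) := by
  obtain ⟨s, hs⟩ : ∃ s : ℚ, s = r := ⟨_, rfl⟩
  have h4 : (1 + PowerSeries.X) * (1 + (r : PowerSeries ℚ) * PowerSeries.X) =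
      1 + PowerSeries.C (s + 1) * PowerSeries.X + PowerSeries.C s * PowerSeries.X ^ 2 := by
    rw [hs, map_add, map_natCast, map_one]
    ring
  rw [h4]
  ext n
  simp only [PowerSeries.coeff_mk, map_add, PowerSeries.coeff_one, PowerSeries.coeff_C_mul,
    PowerSeries.coeff_X_pow]
  match n with
  | 0 => simp [h0]
  | 1 => simp [h1, ← hs]
  | 2 => simp [h2, ← hs]
  | n + 3 => simp [h3]

end Series

/-! ### Dimensions of the pieces of the ring -/

section GradedPieces

variable {k : Type*} [Field k] {R : Type u} [CommRing R] [IsLocalRing R] [Algebra k R]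
  {V : Submodule k R}

local notation "𝔪" => maximalIdeal R
local notation "κ" => ResidueField R

theorem colon_eq_of_socle_eq (hs : socle R R = 𝔪 ^ 2) :
    (⊥ : Ideal R).colon (𝔪 : Set R) = 𝔪 ^ 2 := by
  rw [← hs]
  ext x
  rw [Submodule.mem_colon, mem_socle]
  refine forall₂_congr fun a _ => ?_
  rw [smul_eq_mul, smul_eq_mul, mul_comm, Ideal.mem_bot]

variable [IsArtinianRing R]

theorem finrank_sq_maximalIdeal (hk : Function.Bijective (algebraMap k (ResidueField R)))
    (hs : socle R R = 𝔪 ^ 2) :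
    Module.finrank k ((𝔪 ^ 2).restrictScalars k) = ell R (κ →ₗ[R] R) := by
  rw [finrank_restrictScalars_eq_ell hk, ← hs, ell_socle_self]

theorem finrank_cotangentComplement (hk : Function.Bijective (algebraMap k (ResidueField R)))
    (hs : socle R R = 𝔪 ^ 2) (hL : ell R R = 2 * (1 + ell R (κ →ₗ[R] R)))
    (hV : IsCotangentComplement V) : Module.finrank k V = ell R (κ →ₗ[R] R) + 1 := by
  have := finite_of_coefficientField (R := R) hk R
  have h1 := Submodule.finrank_sup_add_finrank_inf_eq V ((𝔪 ^ 2).restrictScalars k)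
  have h3 := ell_quotient_add_ell (R := R) 𝔪
  have h4 : ell R (R ⧸ 𝔪) = 1 := ell_residueField
  rw [hV.sup_eq, hV.disjoint.eq_bot, finrank_bot, finrank_restrictScalars_eq_ell hk,
    finrank_sq_maximalIdeal hk hs] at h1
  rw [h4, hL] at h3
  omega

end GradedPieces

/-! ### The structure theorem -/

theorem mainTheorem1 {k : Type*} [Field k] {R : Type u} [CommRing R] [IsLocalRing R]
    [IsNoetherianRing R] [Algebra k R]
    (hk : Function.Bijective (algebraMap k (ResidueField R)))
    (hGor : ¬ IsGorensteinLocalRing R)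
    (h3 : maximalIdeal R ^ 3 = ⊥) (h2 : maximalIdeal R ^ 2 ≠ ⊥)
    (r : ℕ) (hr : r = typeOfLocalRing k R)
    (hex : ∃ (N : Type u) (_ : AddCommGroup N) (_ : Module R N),
      Module.Finite R N ∧ ¬ Module.Free R N ∧ HasGDimensionZero R N) :
    ∃ (𝒜 : ℕ → Submodule k R) (_ : GradedAlgebra 𝒜),
      -- the homogeneous grading `R = R_0 ⊕ R_1 ⊕ R_2`
      (IsHomogeneousGraded 𝒜 ∧ (∀ i, 3 ≤ i → 𝒜 i = ⊥) ∧
        Module.finrank k (𝒜 1) = r + 1 ∧ Module.finrank k (𝒜 2) = r ∧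
        hilbertSeries 𝒜 = (1 + PowerSeries.X) * (1 + (r : PowerSeries ℚ) * PowerSeries.X) ∧
        (⊥ : Ideal R).colon (maximalIdeal R : Set R) = maximalIdeal R ^ 2) ∧
      -- Koszul property and Poincaré series
      (IsKoszulGraded 𝒜 ∧
        poincareSeries k R =
          ((1 - PowerSeries.X) * (1 - (r : PowerSeries ℚ) * PowerSeries.X))⁻¹) ∧
      -- Bass series
      bassSeries k R =
        ((r : PowerSeries ℚ) - PowerSeries.X) *
          (1 - (r : PowerSeries ℚ) * PowerSeries.X)⁻¹ ∧
      -- modules of G-dimension zero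
      (∀ (M : Type u) [AddCommGroup M] [Module R M] [Module.Finite R M] [Module k M]
          [IsScalarTower k R M], HasGDimensionZero R M →
        (∃ ℳ : ℕ → Submodule k M, IsModuleGrading 𝒜 ℳ) ∧
        (HasNoFreeSummand R M →
          ∃ (ℳ : ℕ → Submodule k M) (b : ℕ), IsModuleGrading 𝒜 ℳ ∧
            (∀ i, 2 ≤ i → ℳ i = ⊥) ∧
            b = Module.finrank k (ℳ 0) ∧
            b = (⊤ : Submodule R M).spanFinrank ∧
            Module.finrank k (ℳ 1) = r * b ∧
            Module.length R M = ((b * (1 + r) : ℕ) : ℕ∞) ∧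
            HasLinearResolution 𝒜 ℳ (fun _ => b))) := by
  have : IsArtinianRing R := (isArtinianRing_iff_isNilpotent_maximalIdeal R).mpr ⟨3, h3⟩
  have hr' : ell R (ResidueField R →ₗ[R] R) = r := by rw [hr, typeOfLocalRing, kdim_eq_ell hk]
  -- a nonfree module of G-dimension zero has a nonzero stable summand
  obtain ⟨M', _, _, hM'fin, hM'free, hM'⟩ := hex
  obtain ⟨n, N, _, _, _, hN, ⟨e⟩⟩ := hM'.exists_equiv_free_prod
  have : Nontrivial N := by
    by_contra hN'
    have := not_nontrivial_iff_subsingleton.mp hN'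
    exact hM'free (Module.Free.of_equiv e.symm)
  have hs := socle_self_eq hN h3 hGor
  have hL := ell_self_eq hN h3 hGor hs
  obtain ⟨V, hV⟩ := exists_isCotangentComplement k R
  let := shortGradedAlgebra hk h3 hV
  have hV1 : Module.finrank k V = r + 1 := hr' ▸ finrank_cotangentComplement hk hs hL hV
  have hV2 : Module.finrank k ((maximalIdeal R ^ 2).restrictScalars k) = r :=
    hr' ▸ finrank_sq_maximalIdeal hk hs
  have hext (n) : ell R (ExtM R (ResidueField R) (ResidueField R) n) = betti r n :=
    hr' ▸ ell_ext_residueField_eq_betti hN h3 hGor hs n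
  obtain ⟨d, hd0, hd, hdeg⟩ :=
    exists_linear_resolution_residueField hk h3 hV hs hr' (hr' ▸ hL) hext
  refine ⟨shortGrading V, this, ⟨isHomogeneousGraded_shortGrading hk h3 hV, ?_, hV1, hV2, ?_,
    colon_eq_of_socle_eq hs⟩, ⟨isKoszulGraded_shortGrading hk h3 hV d hd0 hd hdeg, ?_⟩, ?_, ?_⟩
  · intro i hi
    obtain ⟨i, rfl⟩ := Nat.exists_eq_add_of_le' hi
    rfl
  · refine mk_eq_hilbert ?_ hV1 hV2 fun n => finrank_bot k R
    have := LinearMap.finrank_range_of_inj (f := Algebra.linearMap k R) (algebraMap k R).injective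
    rw [Module.finrank_self] at this
    exact this
  · have hβ (n) : kdim k R (((Tor (ModuleCat.{u} R) n).obj (ModuleCat.of R (ResidueField R))).obj
        (ModuleCat.of R (ResidueField R))) = betti r n := by
      obtain ⟨e⟩ := nonempty_tor_residueField_equiv (betti r) d _ surjective_residue_proj
        (LinearMap.exact_iff.mpr (ker_residue_proj.trans hd0.symm)) hd
        (fun n => apply_mem_maximalIdeal_of_degree hV (d n) (hdeg n)) n
      have := Module.Finite.equiv e.symm
      rw [kdim_eq_ell hk, ell_congr e, ell_pi, ell_residueField, mul_one]
    rw [← mk_betti, poincareSeries]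
    simp only [hβ]
  · have hμ (n) : kdim k R (Abelian.Ext (ModuleCat.of R (ResidueField R)) (ModuleCat.of R R) n) =
        ell R (ExtM R (ResidueField R) R n) := kdim_eq_ell hk (ExtM R (ResidueField R) R n)
    rw [bassSeries]
    simp only [hμ]
    refine mk_eq_bass ?_ ?_ fun n => ?_
    · rw [ell_congr (extZeroEquiv R (ResidueField R) R), hr']
    · rw [ext_one_add_one_eq hN h3 hGor hs, hr']
    · rw [ext_succ_succ_eq hN h3 hGor hs, hr']
  · intro M _ _ _ _ _ hM
    constructor
    · obtain ⟨n, N, _, _, _, hN, ⟨e⟩⟩ := hM.exists_equiv_free_prod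
      let : Module k N := Module.compHom N (algebraMap k R)
      have : IsScalarTower k R N := IsScalarTower.of_algebraMap_smul fun _ _ => rfl
      obtain ⟨N₀, hN₀⟩ := Submodule.exists_isCompl
        ((maximalIdeal R • ⊤ : Submodule R N).restrictScalars k)
      obtain ⟨h4, h5⟩ := hN.isModuleGrading h3 hV hN₀.symm
      exact exists_isModuleGrading_of_equiv hk h3 hV e h4 h5
    · intro hfree
      have hst : IsStableGZero R M := ⟨hM, hfree.apply_mem⟩
      obtain ⟨M₀, hM₀⟩ := Submodule.exists_isCompl
        ((maximalIdeal R • ⊤ : Submodule R M).restrictScalars k)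
      have hℳ := (hst.isModuleGrading h3 hV hM₀.symm).2
      refine ⟨_, numGen R M, hℳ, fun i hi => ?_,
        (exists_cover_of_isCompl hk M₀ hM₀.symm).1.symm, numGen_eq_spanFinrank M, ?_, ?_,
        hst.hasLinearResolution hk h3 hGor hs hV hℳ hM₀.symm⟩
      · obtain ⟨i, rfl⟩ := Nat.exists_eq_add_of_le' hi
        obtain _ | i := i <;> rfl
      · exact (finrank_restrictScalars_eq_ell hk _).trans
          (by rw [hst.ell_smul_top h3 hGor hs, hr', mul_comm])
      · rw [← coe_ell, hst.ell_eq h3 hGor hs, hr']
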